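/- All manifolds are real, finite-dimensional, Hausdorff, second countable and $C^\infty$, and all maps, sections, forms and distributions are $C^\infty$. **Setting.** Let $M$ be an $m$-dimensional manifold with a volume form $\eta$, let $\pi\colon E\to M$ be a smooth bundle (a surjective submersion, for instance any fibre bundle) with $\dim E=m+n$, and let $J^1\pi$ be its first-order jet bundle, with projections $\pi^1\colon J^1\pi\to E$, $j^1_x\phi\mapsto\phi(x)$, and $\bar\pi^1=\pi\circ\pi^1\colon J^1\pi\to M$. Write $\Gamma(\cdot)$ for local sections over open subsets of the base. Let $\mathcal L=L\,(\bar\pi^1)^*\eta$, with $L\in C^\infty(J^1\pi)$, be a regular Lagrangian density, i.e. the Hessian of $L$ restricted to each affine fibre of $\pi^1$, with matrix $\bigl(\partial^2L/\partial u^\alpha_i\partial u^\beta_j\bigr)$, is nondegenerate. Let $\Theta_{\mathcal L}=i(\nu)\,\mathrm d\mathcal L+\mathcal L$ be the Cartan $m$-form, $\nu$ being the canonical vertical endomorphism of $J^1\pi$, and $\Omega_{\mathcal L}=-\mathrm d\Theta_{\mathcal L}$; in coordinates $(x^i,u^\alpha,u^\alpha_i)$ with $\eta=\mathrm d^mx$,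 $$\Theta_{\mathcal L}=\frac{\partial L}{\partial u^\alpha_i}\,\mathrm du^\alpha\wedge\mathrm d^{m-1}x_i-\Bigl(\frac{\partial L}{\partial u^\alpha_i}u^\alpha_i-L\Bigr)\mathrm d^mx,\qquad \mathrm d^{m-1}x_i=i(\partial/\partial x^i)\,\mathrm d^mx .$$ A section $s$ is an *integral section* of a distribution $\mathcal D$ if $T_q\,\mathrm{Im}(s)=\mathcal D_q$ for every $q\in\mathrm{Im}(s)$; a distribution transverse to the fibres is *integrable* if there is an integral section through every point. Let $\mathcal D_{\mathcal L}$ be a solution of the Lagrangian problem: an $m$-dimensional, $\bar\pi^1$-transverse, integrable distribution in $J^1\pi$ whose integral sections are prolongations $j^1\phi$ of sections $\phi\in\Gamma(\pi)$ with $(j^1\phi)^*\,i(X)\,\Omega_{\mathcal L}=0$ for every vector field $X$ on $J^1\pi$. A *jet field* is a global section $\Psi\colon E\to J^1\pi$ of $\pi^1$. It is *integrable* if the associated distribution $\mathcal D(\Psi)$ in $E$, $\mathcal D(\Psi)_u=T_x\phi(T_xM)$ for $\Psi(u)=j^1_x\phi$, is integrable. Let $T\pi^1(\mathcal D_{\mathcal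 L}|_{\mathrm{Im}(\Psi)})$ be the distribution in $E$ given at $u\in E$ by $T\pi^1\bigl((\mathcal D_{\mathcal L})_{\Psi(u)}\bigr)$. An integrable jet field $\Psi$ is a *solution of the generalized Lagrangian Hamilton–Jacobi problem* if $T\pi^1(\mathcal D_{\mathcal L}|_{\mathrm{Im}(\Psi)})$ is an $m$-dimensional integrable distribution and, for each of its integral sections $\gamma\in\Gamma(\pi)$, $\Psi\circ\gamma$ is an integral section of $\mathcal D_{\mathcal L}$. It is a *solution of the Lagrangian Hamilton–Jacobi problem* if moreover $\Psi^*\Omega_{\mathcal L}=0$. The submanifold $\mathrm{Im}(\Psi)\hookrightarrow J^1\pi$ is *$m$-Lagrangian* if, for every $\bar u\in\mathrm{Im}(\Psi)$ and $F=T_{\bar u}\mathrm{Im}(\Psi)$, $$F=\{w\in T_{\bar u}J^1\pi:\ (\Omega_{\mathcal L})_{\bar u}(w,v_1,\dots,v_m)=0\ \text{ for all } v_1,\dots,v_m\in F\}.$$ **Proposition.** Let $\Psi$ be an integrable jet field with $\Psi^*\Omega_{\mathcal L}=0$. Then the following statements are equivalent: 1. $\Psi$ is a solution of the Lagrangian Hamilton–Jacobi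 problem. 2. The submanifold $\mathrm{Im}(\Psi)\hookrightarrow J^1\pi$ is $m$-Lagrangian and $\mathcal D_{\mathcal L}$ is tangent to it, that is, $(\mathcal D_{\mathcal L})_{\bar u}\subseteq T_{\bar u}\mathrm{Im}(\Psi)$ for every $\bar u\in\mathrm{Im}(\Psi)$. 3. The integral sections of $\mathcal D_{\mathcal L}$ with boundary conditions in $\mathrm{Im}(\Psi)$ project onto the integral sections of $T\pi^1(\mathcal D_{\mathcal L}|_{\mathrm{Im}(\Psi)})$: for every integral section $\psi$ of $\mathcal D_{\mathcal L}$ on a connected open set $U$ with $\psi(x)\in\mathrm{Im}(\Psi)$ for some $x\in U$, $\pi^1\circ\psi$ is an integral section of $T\pi^1(\mathcal D_{\mathcal L}|_{\mathrm{Im}(\Psi)})$, and every integral section of the latter on a nonempty connected open set arises in this way. -/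

import Mathlib

set_option maxSynthPendingDepth 3
set_option linter.unusedSectionVars false

open scoped Manifold ContDiff Topology

noncomputable section

section FirstJetBundle

variable {B F M E : Type*}
  [NormedAddCommGroup B] [NormedSpace ℝ B]
  [NormedAddCommGroup F] [NormedSpace ℝ F]
  [TopologicalSpace M] [ChartedSpace B M]
  [TopologicalSpace E] [ChartedSpace (B × F) E]

variable (B F M E) in
/-- A smooth bundle `proj : E → M` over a manifold `M` modelled on `B`, whose total space `E` is
modelled on `B × F`: a surjective submersion. (Every smooth locally trivial fibre bundle whose
fibres are modelled on `F` is one.) -/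
structure SmoothBundle where
  proj : E → M
  surjective : Function.Surjective proj
  submersion : ∀ u : E, Manifold.IsSubmersionAtOfComplement F 𝓘(ℝ, B × F) 𝓘(ℝ, B) ∞ proj u

/-- Local coordinates `(x, u)` on `E`, adapted to the bundle: a chart of `M` and a chart of `E`
in which the projection reads `(x, u) ↦ x`. -/
structure AdaptedChart (π : SmoothBundle B F M E) where
  base : OpenPartialHomeomorph M B
  tot : OpenPartialHomeomorph E (B × F)
  base_mem : base ∈ IsManifold.maximalAtlas 𝓘(ℝ, B) ∞ M
  tot_mem : tot ∈ IsManifold.maximalAtlas 𝓘(ℝ, B × F) ∞ E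
  proj_mem : ∀ u ∈ tot.source, π.proj u ∈ base.source
  base_proj : ∀ u ∈ tot.source, base (π.proj u) = (tot u).1

theorem SmoothBundle.contMDiff (π : SmoothBundle B F M E)
    [IsManifold 𝓘(ℝ, B) ∞ M] [IsManifold 𝓘(ℝ, B × F) ∞ E] :
    ContMDiff 𝓘(ℝ, B × F) 𝓘(ℝ, B) ∞ π.proj := fun u => (π.submersion u).contMDiffAt

theorem SmoothBundle.mdifferentiableAt (π : SmoothBundle B F M E)
    [IsManifold 𝓘(ℝ, B) ∞ M] [IsManifold 𝓘(ℝ, B × F) ∞ E] (u : E) :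
    MDifferentiableAt 𝓘(ℝ, B × F) 𝓘(ℝ, B) π.proj u :=
  (π.contMDiff u).mdifferentiableAt (by simp)

theorem SmoothBundle.exists_adaptedChart (π : SmoothBundle B F M E)
    [IsManifold 𝓘(ℝ, B × F) ∞ E] (u : E) :
    ∃ A : AdaptedChart π, u ∈ A.tot.source := by
  have h := π.submersion u
  let e : OpenPartialHomeomorph (B × F) (B × F) := h.equiv.toHomeomorph.toOpenPartialHomeomorph
  refine ⟨⟨h.codChart, h.domChart.trans e, h.codChart_mem_maximalAtlas, ?_, ?_, ?_⟩, ?_⟩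
  · apply OpenPartialHomeomorph.mem_maximalAtlas_of_contMDiffOn
    · have h1 : ContMDiff 𝓘(ℝ, B × F) 𝓘(ℝ, B × F) ∞ h.equiv := h.equiv.contDiff.contMDiff
      have h2 := contMDiffOn_of_mem_maximalAtlas h.domChart_mem_maximalAtlas
      exact (h1.comp_contMDiffOn h2).mono (by intro x hx; simpa [e] using hx)
    · have h1 : ContMDiff 𝓘(ℝ, B × F) 𝓘(ℝ, B × F) ∞ h.equiv.symm :=
        h.equiv.symm.contDiff.contMDiff
      have h2 := contMDiffOn_symm_of_mem_maximalAtlas h.domChart_mem_maximalAtlas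
      exact h2.comp h1.contMDiffOn (by intro x hx; simpa [e] using hx)
  · intro v hv
    exact h.source_subset_preimage_source (by simpa [e] using hv)
  · intro v hv
    have hv' : v ∈ h.domChart.source := by simpa [e] using hv
    have hm : h.domChart v ∈ (h.domChart.extend 𝓘(ℝ, B × F)).target := by simp [hv']
    have := h.writtenInCharts hm
    simpa [e, hv'] using this
  · simpa [e] using h.mem_domChart_source

/-- A point of the first-order jet bundle `J¹π`. The 1-jet `j¹ₓφ` of a local section `φ` is given by
the point `φ x` and the tangent map `Tₓφ : TₓM → T_{φ x}E`; the maps that arise in this way are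
exactly the linear sections of `Tπ : T_{φ x}E → TₓM`. -/
structure FirstJet (π : SmoothBundle B F M E) where
  pt : E
  hor : TangentSpace 𝓘(ℝ, B) (π.proj pt) →L[ℝ] TangentSpace 𝓘(ℝ, B × F) pt
  mfderiv_hor : ∀ v, mfderiv 𝓘(ℝ, B × F) 𝓘(ℝ, B) π.proj pt (hor v) = v

namespace FirstJet

variable {π : SmoothBundle B F M E}

theorem ext_of_eq {j j' : FirstJet π} (h : j.pt = j'.pt)
    (h' : (j.hor : B →L[ℝ] B × F) = (j'.hor : B →L[ℝ] B × F)) : j = j' := by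
  obtain ⟨p, H, hH⟩ := j
  obtain ⟨p', H', hH'⟩ := j'
  obtain rfl : p = p' := h
  obtain rfl : H = H' := h'
  rfl

end FirstJet

namespace AdaptedChart

variable {π : SmoothBundle B F M E}

theorem mdiff_tot (A : AdaptedChart π) {u : E} (hu : u ∈ A.tot.source) :
    MDifferentiableAt 𝓘(ℝ, B × F) 𝓘(ℝ, B × F) A.tot u :=
  (contMDiffAt_of_mem_maximalAtlas A.tot_mem hu).mdifferentiableAt (by simp)

theorem mdiff_tot_symm (A : AdaptedChart π) {y : B × F} (hy : y ∈ A.tot.target) :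
    MDifferentiableAt 𝓘(ℝ, B × F) 𝓘(ℝ, B × F) A.tot.symm y :=
  (contMDiffAt_symm_of_mem_maximalAtlas A.tot_mem hy).mdifferentiableAt (by simp)

theorem mdiff_base (A : AdaptedChart π) {x : M} (hx : x ∈ A.base.source) :
    MDifferentiableAt 𝓘(ℝ, B) 𝓘(ℝ, B) A.base x :=
  (contMDiffAt_of_mem_maximalAtlas A.base_mem hx).mdifferentiableAt (by simp)

theorem mdiff_base_symm (A : AdaptedChart π) {y : B} (hy : y ∈ A.base.target) :
    MDifferentiableAt 𝓘(ℝ, B) 𝓘(ℝ, B) A.base.symm y :=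
  (contMDiffAt_symm_of_mem_maximalAtlas A.base_mem hy).mdifferentiableAt (by simp)

/-- The tangent map of the total chart. -/
def dTot (A : AdaptedChart π) (u : E) : (B × F) →L[ℝ] (B × F) :=
  mfderiv 𝓘(ℝ, B × F) 𝓘(ℝ, B × F) A.tot u

/-- The tangent map of the inverse of the total chart. -/
def dTotSymm (A : AdaptedChart π) (y : B × F) : (B × F) →L[ℝ] (B × F) :=
  mfderiv 𝓘(ℝ, B × F) 𝓘(ℝ, B × F) A.tot.symm y

/-- The tangent map of the base chart. -/
def dBase (A : AdaptedChart π) (x : M) : B →L[ℝ] B :=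
  mfderiv 𝓘(ℝ, B) 𝓘(ℝ, B) A.base x

/-- The tangent map of the inverse of the base chart. -/
def dBaseSymm (A : AdaptedChart π) (y : B) : B →L[ℝ] B :=
  mfderiv 𝓘(ℝ, B) 𝓘(ℝ, B) A.base.symm y

/-- The coordinates `uᵢ^α` of a jet, the derivatives of `u^α`, in adapted coordinates. -/
def velocity (A : AdaptedChart π) (j : FirstJet π) : B →L[ℝ] F :=
  ContinuousLinearMap.snd ℝ B F ∘L A.dTot j.pt ∘L (j.hor : B →L[ℝ] B × F) ∘L
    A.dBaseSymm (A.base (π.proj j.pt))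

/-- The linear map `TₓM → T_uE` whose coordinate expression is `v ↦ (v, p v)`. -/
def horOf (A : AdaptedChart π) (y : B × F) (p : B →L[ℝ] F) : B →L[ℝ] B × F :=
  A.dTotSymm y ∘L (ContinuousLinearMap.id ℝ B).prod p ∘L A.dBase (π.proj (A.tot.symm y))

theorem dBase_comp_dBaseSymm (A A' : AdaptedChart π) {y : B} (hy : y ∈ A.base.target)
    (hy' : A.base.symm y ∈ A'.base.source) :
    A'.dBase (A.base.symm y) ∘L A.dBaseSymm y = fderiv ℝ (A'.base ∘ A.base.symm) y := by
  rw [← mfderiv_eq_fderiv]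
  exact (mfderiv_comp y (A'.mdiff_base hy') (A.mdiff_base_symm hy)).symm

theorem dTot_comp_dTotSymm (A A' : AdaptedChart π) {y : B × F} (hy : y ∈ A.tot.target)
    (hy' : A.tot.symm y ∈ A'.tot.source) :
    A'.dTot (A.tot.symm y) ∘L A.dTotSymm y = fderiv ℝ (A'.tot ∘ A.tot.symm) y := by
  rw [← mfderiv_eq_fderiv]
  exact (mfderiv_comp y (A'.mdiff_tot hy') (A.mdiff_tot_symm hy)).symm

theorem dBase_comp_dBaseSymm_self (A : AdaptedChart π) {y : B} (hy : y ∈ A.base.target) :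
    A.dBase (A.base.symm y) ∘L A.dBaseSymm y = ContinuousLinearMap.id ℝ B := by
  rw [dBase_comp_dBaseSymm A A hy (A.base.map_target hy)]
  have : (A.base ∘ A.base.symm) =ᶠ[𝓝 y] id := by
    filter_upwards [A.base.open_target.mem_nhds hy] with z hz using A.base.right_inv hz
  rw [this.fderiv_eq, fderiv_id]

theorem dTot_comp_dTotSymm_self (A : AdaptedChart π) {y : B × F} (hy : y ∈ A.tot.target) :
    A.dTot (A.tot.symm y) ∘L A.dTotSymm y = ContinuousLinearMap.id ℝ (B × F) := by
  rw [dTot_comp_dTotSymm A A hy (A.tot.map_target hy)]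
  have : (A.tot ∘ A.tot.symm) =ᶠ[𝓝 y] id := by
    filter_upwards [A.tot.open_target.mem_nhds hy] with z hz using A.tot.right_inv hz
  rw [this.fderiv_eq, fderiv_id]

theorem dBaseSymm_comp_dBase_self (A : AdaptedChart π) {x : M} (hx : x ∈ A.base.source) :
    A.dBaseSymm (A.base x) ∘L A.dBase x = ContinuousLinearMap.id ℝ B := by
  have h1 := mfderiv_comp (I := 𝓘(ℝ, B)) (I' := 𝓘(ℝ, B)) (I'' := 𝓘(ℝ, B)) x
    (A.mdiff_base_symm (A.base.map_source hx)) (A.mdiff_base hx)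
  have : (A.base.symm ∘ A.base) =ᶠ[𝓝 x] id := by
    filter_upwards [A.base.open_source.mem_nhds hx] with z hz using A.base.left_inv hz
  rw [this.mfderiv_eq, mfderiv_id] at h1
  exact h1.symm

theorem dTotSymm_comp_dTot_self (A : AdaptedChart π) {u : E} (hu : u ∈ A.tot.source) :
    A.dTotSymm (A.tot u) ∘L A.dTot u = ContinuousLinearMap.id ℝ (B × F) := by
  have h1 := mfderiv_comp (I := 𝓘(ℝ, B × F)) (I' := 𝓘(ℝ, B × F)) (I'' := 𝓘(ℝ, B × F)) u
    (A.mdiff_tot_symm (A.tot.map_source hu)) (A.mdiff_tot hu)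
  have : (A.tot.symm ∘ A.tot) =ᶠ[𝓝 u] id := by
    filter_upwards [A.tot.open_source.mem_nhds hu] with z hz using A.tot.left_inv hz
  rw [this.mfderiv_eq, mfderiv_id] at h1
  exact h1.symm

theorem velocity_of_hor_eq (A : AdaptedChart π) {y : B × F} (hy : y ∈ A.tot.target)
    (p : B →L[ℝ] F) (A' : AdaptedChart π) (hy' : A.tot.symm y ∈ A'.tot.source)
    (j : FirstJet π) (hpt : j.pt = A.tot.symm y) (hhor : (j.hor : B →L[ℝ] B × F) = A.horOf y p) :
    A'.velocity j = ContinuousLinearMap.snd ℝ B F ∘L fderiv ℝ (A'.tot ∘ A.tot.symm) y ∘L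
      (ContinuousLinearMap.id ℝ B).prod p ∘L
        fderiv ℝ (A.base ∘ A'.base.symm) ((A'.tot ∘ A.tot.symm) y).1 := by
  have hus : A.tot.symm y ∈ A.tot.source := A.tot.map_target hy
  have hx := A.proj_mem _ hus
  have hx' := A'.proj_mem _ hy'
  have e1 : A'.base.symm (A'.base (π.proj (A.tot.symm y))) = π.proj (A.tot.symm y) :=
    A'.base.left_inv hx'
  rw [← dTot_comp_dTotSymm A A' hy hy', Function.comp_apply, ← A'.base_proj _ hy',
    ← dBase_comp_dBaseSymm A' A (A'.base.map_source hx') (by rw [e1]; exact hx), e1]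
  unfold velocity
  rw [hhor, hpt]
  rfl

variable [IsManifold 𝓘(ℝ, B) ∞ M] [IsManifold 𝓘(ℝ, B × F) ∞ E]

theorem fst_comp_dTot (A : AdaptedChart π) {u : E} (hu : u ∈ A.tot.source) :
    ContinuousLinearMap.fst ℝ B F ∘L A.dTot u =
      A.dBase (π.proj u) ∘L (mfderiv 𝓘(ℝ, B × F) 𝓘(ℝ, B) π.proj u : B × F →L[ℝ] B) := by
  have h1 := mfderiv_comp (I := 𝓘(ℝ, B × F)) (I' := 𝓘(ℝ, B)) (I'' := 𝓘(ℝ, B)) u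
    (A.mdiff_base (A.proj_mem u hu)) (π.mdifferentiableAt u)
  have hf : MDifferentiableAt 𝓘(ℝ, B × F) 𝓘(ℝ, B) (Prod.fst : B × F → B) (A.tot u) :=
    (ContinuousLinearMap.fst ℝ B F).differentiableAt.mdifferentiableAt
  have h2 := mfderiv_comp (I := 𝓘(ℝ, B × F)) (I' := 𝓘(ℝ, B × F)) (I'' := 𝓘(ℝ, B)) u
    hf (A.mdiff_tot hu)
  have : (A.base ∘ π.proj) =ᶠ[𝓝 u] (Prod.fst ∘ A.tot) := by
    filter_upwards [A.tot.open_source.mem_nhds hu] with z hz using A.base_proj z hz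
  rw [this.mfderiv_eq, h2, mfderiv_eq_fderiv] at h1
  have h3 : fderiv ℝ (Prod.fst : B × F → B) (A.tot u) = ContinuousLinearMap.fst ℝ B F :=
    (ContinuousLinearMap.fst ℝ B F).fderiv
  rw [h3] at h1
  exact h1

theorem proj_horOf (A : AdaptedChart π) {y : B × F} (hy : y ∈ A.tot.target) (p : B →L[ℝ] F)
    (v : B) :
    (mfderiv 𝓘(ℝ, B × F) 𝓘(ℝ, B) π.proj (A.tot.symm y) : B × F →L[ℝ] B) (A.horOf y p v) = v := by
  set u := A.tot.symm y with hu
  have hus : u ∈ A.tot.source := A.tot.map_target hy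
  have hx := A.proj_mem u hus
  have h1 := DFunLike.congr_fun (A.fst_comp_dTot hus) (A.horOf y p v)
  have h2 := DFunLike.congr_fun (A.dTot_comp_dTotSymm_self hy)
    (A.dBase (π.proj u) v, p (A.dBase (π.proj u) v))
  have h3 : A.dTot u (A.horOf y p v) = (A.dBase (π.proj u) v, p (A.dBase (π.proj u) v)) := h2
  have h4 : A.dBase (π.proj u) v = A.dBase (π.proj u)
      ((mfderiv 𝓘(ℝ, B × F) 𝓘(ℝ, B) π.proj u : B × F →L[ℝ] B) (A.horOf y p v)) := by
    have h5 : (A.dTot u (A.horOf y p v)).1 = _ := h1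
    rw [h3] at h5
    exact h5
  have h6 := congrArg (A.dBaseSymm (A.base (π.proj u))) h4
  have h7 := A.dBaseSymm_comp_dBase_self hx
  have h8 : ∀ w, A.dBaseSymm (A.base (π.proj u)) (A.dBase (π.proj u) w) = w :=
    fun w => DFunLike.congr_fun h7 w
  exact ((h8 v).symm.trans (h6.trans (h8 _))).symm

open Classical in
/-- The coordinates `(x, u, uᵢ)` on `J¹π` induced by adapted coordinates `(x, u)` on `E`. -/
def jetCoord (A : AdaptedChart π) (j₀ : FirstJet π) :
    PartialEquiv (FirstJet π) ((B × F) × (B →L[ℝ] F)) where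
  toFun j := (A.tot j.pt, A.velocity j)
  invFun z := if h : z.1 ∈ A.tot.target then
      ⟨A.tot.symm z.1, A.horOf z.1 z.2, A.proj_horOf h z.2⟩ else j₀
  source := {j | j.pt ∈ A.tot.source}
  target := {z | z.1 ∈ A.tot.target}
  map_source' j hj := A.tot.map_source hj
  map_target' z hz := by
    have hz' : z.1 ∈ A.tot.target := hz
    simp [hz']
  left_inv' j hj := by
    have hj' : j.pt ∈ A.tot.source := hj
    have hx := A.proj_mem _ hj'
    rw [dif_pos (A.tot.map_source hj')]
    refine FirstJet.ext_of_eq (A.tot.left_inv hj') ?_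
    change A.horOf (A.tot j.pt) (A.velocity j) = _
    ext1 v
    set b := A.dBase (π.proj j.pt) v with hb
    have h8 : A.dBaseSymm (A.base (π.proj j.pt)) b = v :=
      DFunLike.congr_fun (A.dBaseSymm_comp_dBase_self hx) v
    have h1 : (A.dTot j.pt ((j.hor : B →L[ℝ] B × F) v)).1 = b := by
      have h5 := DFunLike.congr_fun (A.fst_comp_dTot hj') ((j.hor : B →L[ℝ] B × F) v)
      have h6 : (mfderiv 𝓘(ℝ, B × F) 𝓘(ℝ, B) π.proj j.pt : B × F →L[ℝ] B)
          ((j.hor : B →L[ℝ] B × F) v) = v := j.mfderiv_hor v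
      have h7 : (A.dTot j.pt ((j.hor : B →L[ℝ] B × F) v)).1 = A.dBase (π.proj j.pt)
        ((mfderiv 𝓘(ℝ, B × F) 𝓘(ℝ, B) π.proj j.pt : B × F →L[ℝ] B)
          ((j.hor : B →L[ℝ] B × F) v)) := h5
      rw [h7, h6]
    have h2 : A.velocity j b = (A.dTot j.pt ((j.hor : B →L[ℝ] B × F) v)).2 := by
      change (A.dTot j.pt ((j.hor : B →L[ℝ] B × F) (A.dBaseSymm _ b))).2 = _
      rw [h8]
    have h3 : A.horOf (A.tot j.pt) (A.velocity j) v =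
        A.dTotSymm (A.tot j.pt) (b, A.velocity j b) := by
      change A.dTotSymm (A.tot j.pt) (A.dBase (π.proj (A.tot.symm (A.tot j.pt))) v,
        A.velocity j (A.dBase (π.proj (A.tot.symm (A.tot j.pt))) v)) = _
      rw [A.tot.left_inv hj']
    rw [h3, h2, ← h1, Prod.mk.eta]
    exact DFunLike.congr_fun (A.dTotSymm_comp_dTot_self hj') ((j.hor : B →L[ℝ] B × F) v)
  right_inv' z hz := by
    have hz' : z.1 ∈ A.tot.target := hz
    have hus := A.tot.map_target hz'
    have hx := A.proj_mem _ hus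
    rw [dif_pos hz']
    refine Prod.ext (A.tot.right_inv hz') ?_
    change A.velocity _ = z.2
    rw [A.velocity_of_hor_eq hz' z.2 A hus _ rfl rfl, ← dTot_comp_dTotSymm A A hz' hus,
      dTot_comp_dTotSymm_self A hz', Function.comp_apply, ← A.base_proj _ hus]
    have e1 : A.base.symm (A.base (π.proj (A.tot.symm z.1))) = π.proj (A.tot.symm z.1) :=
      A.base.left_inv hx
    rw [← dBase_comp_dBaseSymm A A (A.base.map_source hx) (by rw [e1]; exact hx),
      dBase_comp_dBaseSymm_self A (A.base.map_source hx)]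
    ext v
    rfl

/-- The change of induced coordinates on `J¹π`. -/
def transition (A A' : AdaptedChart π) (z : (B × F) × (B →L[ℝ] F)) :
    (B × F) × (B →L[ℝ] F) :=
  ((A'.tot ∘ A.tot.symm) z.1, ContinuousLinearMap.snd ℝ B F ∘L
    fderiv ℝ (A'.tot ∘ A.tot.symm) z.1 ∘L (ContinuousLinearMap.id ℝ B).prod z.2 ∘L
      fderiv ℝ (A.base ∘ A'.base.symm) ((A'.tot ∘ A.tot.symm) z.1).1)

theorem jetCoord_trans_source (A A' : AdaptedChart π) (j₀ j₀' : FirstJet π) :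
    ((A.jetCoord j₀).symm.trans (A'.jetCoord j₀')).source =
      {z | z.1 ∈ (A.tot.symm.trans A'.tot).source} := by
  ext z
  by_cases hz : z.1 ∈ A.tot.target
  · simp [jetCoord, PartialEquiv.trans_source, hz]
  · simp [jetCoord, PartialEquiv.trans_source, hz]

theorem jetCoord_trans_eqOn (A A' : AdaptedChart π) (j₀ j₀' : FirstJet π) :
    Set.EqOn ((A.jetCoord j₀).symm.trans (A'.jetCoord j₀')) (transition A A')
      {z | z.1 ∈ (A.tot.symm.trans A'.tot).source} := by
  intro z hz
  have hz1 : z.1 ∈ A.tot.target := by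
    have := hz; simp at this; exact this.1
  have hz2 : A.tot.symm z.1 ∈ A'.tot.source := by
    have := hz; simp at this; exact this.2
  have e : ((A.jetCoord j₀).symm z) =
      ⟨A.tot.symm z.1, A.horOf z.1 z.2, A.proj_horOf hz1 z.2⟩ := dif_pos hz1
  rw [PartialEquiv.coe_trans, Function.comp_apply, e]
  refine Prod.ext rfl ?_
  exact A.velocity_of_hor_eq hz1 z.2 A' hz2 _ rfl rfl

theorem contDiffOn_transition (A A' : AdaptedChart π) :
    ContDiffOn ℝ ∞ (transition A A') {z | z.1 ∈ (A.tot.symm.trans A'.tot).source} := by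
  have hT : ContDiffOn ℝ ∞ (A'.tot ∘ A.tot.symm) (A.tot.symm.trans A'.tot).source := by
    have h1 := contMDiffOn_of_mem_maximalAtlas A'.tot_mem
    have h2 := contMDiffOn_symm_of_mem_maximalAtlas A.tot_mem
    have h3 := h1.comp (h2.mono (t := (A.tot.symm.trans A'.tot).source)
      (fun x hx => hx.1))
      (fun x hx => hx.2)
    exact h3.contDiffOn
  have hB : ContDiffOn ℝ ∞ (A.base ∘ A'.base.symm) (A'.base.symm.trans A.base).source := by
    have h1 := contMDiffOn_of_mem_maximalAtlas A.base_mem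
    have h2 := contMDiffOn_symm_of_mem_maximalAtlas A'.base_mem
    have h3 := h1.comp (h2.mono (t := (A'.base.symm.trans A.base).source)
      (fun x hx => hx.1))
      (fun x hx => hx.2)
    exact h3.contDiffOn
  have hT' := hT.fderiv_of_isOpen (m := ∞) (A.tot.symm.trans A'.tot).open_source (by simp)
  have hB' := hB.fderiv_of_isOpen (m := ∞) (A'.base.symm.trans A.base).open_source (by simp)
  have hfst : ContDiffOn ℝ ∞ (Prod.fst : (B × F) × (B →L[ℝ] F) → B × F)
      {z | z.1 ∈ (A.tot.symm.trans A'.tot).source} := contDiff_fst.contDiffOn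
  have hTz := hT.comp hfst (fun z hz => hz)
  have hTz' := hT'.comp hfst (fun z hz => hz)
  have hBz' := hB'.comp (contDiff_fst.comp_contDiffOn hTz) (by
    intro z hz
    have hz1 : z.1 ∈ A.tot.target := by
      have := hz; simp at this; exact this.1
    have hz2 : A.tot.symm z.1 ∈ A'.tot.source := by
      have := hz; simp at this; exact this.2
    have hx := A.proj_mem _ (A.tot.map_target hz1)
    have hx' := A'.proj_mem _ hz2
    have h1 : (A'.tot (A.tot.symm z.1)).1 = _ := (A'.base_proj _ hz2).symm
    simp only [Set.mem_preimage, Function.comp_apply, OpenPartialHomeomorph.trans_source,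
      OpenPartialHomeomorph.symm_source, Set.mem_inter_iff, h1]
    exact ⟨A'.base.map_source hx', by rw [A'.base.left_inv hx']; exact hx⟩)
  have hp : ContDiffOn ℝ ∞ (fun z : (B × F) × (B →L[ℝ] F) =>
      (ContinuousLinearMap.id ℝ B).prod z.2)
      {z | z.1 ∈ (A.tot.symm.trans A'.tot).source} := by
    have : (fun z : (B × F) × (B →L[ℝ] F) => (ContinuousLinearMap.id ℝ B).prod z.2) =
        fun z => ContinuousLinearMap.inl ℝ B F ∘L ContinuousLinearMap.id ℝ B +
          ContinuousLinearMap.inr ℝ B F ∘L z.2 := by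
      funext z
      ext v <;> simp
    rw [this]
    exact (contDiff_const.add (contDiff_const.clm_comp contDiff_snd)).contDiffOn
  exact hTz.prodMk (contDiffOn_const.clm_comp (hTz'.clm_comp (hp.clm_comp hBz')))

end AdaptedChart

namespace FirstJet

variable (π : SmoothBundle B F M E)
  [IsManifold 𝓘(ℝ, B) ∞ M] [IsManifold 𝓘(ℝ, B × F) ∞ E]

/-- The atlas of `J¹π` consisting of the coordinates induced by adapted coordinates on `E`. -/
def chartedSpaceCore : ChartedSpaceCore ((B × F) × (B →L[ℝ] F)) (FirstJet π) where
  atlas := {e | ∃ (A : AdaptedChart π) (j₀ : FirstJet π), e = A.jetCoord j₀}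
  chartAt j := (π.exists_adaptedChart j.pt).choose.jetCoord j
  mem_chart_source j := (π.exists_adaptedChart j.pt).choose_spec
  chart_mem_atlas j := ⟨_, j, rfl⟩
  open_source := by
    rintro _ _ ⟨A, j₀, rfl⟩ ⟨A', j₀', rfl⟩
    rw [AdaptedChart.jetCoord_trans_source]
    exact (A.tot.symm.trans A'.tot).open_source.preimage continuous_fst
  continuousOn_toFun := by
    rintro _ _ ⟨A, j₀, rfl⟩ ⟨A', j₀', rfl⟩
    rw [AdaptedChart.jetCoord_trans_source]
    exact (AdaptedChart.contDiffOn_transition A A').continuousOn.congr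
      (AdaptedChart.jetCoord_trans_eqOn A A' j₀ j₀')

instance : TopologicalSpace (FirstJet π) := (chartedSpaceCore π).toTopologicalSpace

instance : ChartedSpace ((B × F) × (B →L[ℝ] F)) (FirstJet π) :=
  (chartedSpaceCore π).toChartedSpace

instance : IsManifold 𝓘(ℝ, (B × F) × (B →L[ℝ] F)) ∞ (FirstJet π) := by
  apply isManifold_of_contDiffOn
  intro e e' he he'
  obtain ⟨_, ⟨A, j₀, rfl⟩, he⟩ := Set.mem_iUnion₂.1 he
  obtain ⟨_, ⟨A', j₀', rfl⟩, he'⟩ := Set.mem_iUnion₂.1 he'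
  obtain rfl := Set.mem_singleton_iff.1 he
  obtain rfl := Set.mem_singleton_iff.1 he'
  have h := (AdaptedChart.contDiffOn_transition A A').congr
    (AdaptedChart.jetCoord_trans_eqOn A A' j₀ j₀')
  rw [← AdaptedChart.jetCoord_trans_source A A' j₀ j₀'] at h
  simp only [modelWithCornersSelf_coe, modelWithCornersSelf_coe_symm, Function.id_comp,
    Function.comp_id, Set.range_id, Set.inter_univ, Set.preimage_id]
  exact h

end FirstJet

end FirstJetBundle

section DifferentialForms

variable {H N : Type*} [NormedAddCommGroup H] [NormedSpace ℝ H]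
  [TopologicalSpace N] [ChartedSpace H N]

variable (H N) in
/-- (Not necessarily smooth) differential forms of degree `k` on a manifold `N` modelled on `H`. -/
abbrev DiffForm (k : ℕ) := (p : N) → TangentSpace 𝓘(ℝ, H) p [⋀^Fin k]→L[ℝ] ℝ

/-- The expression of a differential form in a chart. -/
def DiffForm.inChart {k : ℕ} (α : DiffForm H N k) (e : OpenPartialHomeomorph N H) (y : H) :
    H [⋀^Fin k]→L[ℝ] ℝ :=
  (α (e.symm y)).compContinuousLinearMap (mfderiv 𝓘(ℝ, H) 𝓘(ℝ, H) e.symm y)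

/-- Smoothness of a differential form, in charts. -/
def DiffForm.IsSmooth {k : ℕ} (α : DiffForm H N k) : Prop :=
  ∀ e ∈ atlas H N, ContDiffOn ℝ ∞ (α.inChart e) e.target

/-- The exterior derivative of a differential form on a manifold, computed in a chart. -/
def DiffForm.extDeriv {k : ℕ} (α : DiffForm H N k) : DiffForm H N (k + 1) := fun p =>
  (_root_.extDeriv (α.inChart (chartAt H p)) (chartAt H p p)).compContinuousLinearMap
    (mfderiv 𝓘(ℝ, H) 𝓘(ℝ, H) (chartAt H p) p)

/-- A volume form: a nowhere vanishing smooth form of degree `dim N`. -/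
def DiffForm.IsVolumeForm {k : ℕ} (α : DiffForm H N k) : Prop :=
  k = Module.finrank ℝ H ∧ α.IsSmooth ∧ ∀ p, α p ≠ 0

end DifferentialForms

section Distributions

variable {B H M N : Type*} [NormedAddCommGroup B] [NormedSpace ℝ B]
  [NormedAddCommGroup H] [NormedSpace ℝ H]
  [TopologicalSpace M] [ChartedSpace B M] [TopologicalSpace N] [ChartedSpace H N]

/-- A vector field is smooth on the set `U`. -/
def IsSmoothVectorFieldOn (X : (p : N) → TangentSpace 𝓘(ℝ, H) p) [IsManifold 𝓘(ℝ, H) ∞ N]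
    (U : Set N) : Prop :=
  ContMDiffOn 𝓘(ℝ, H) 𝓘(ℝ, H).tangent ∞ (fun p => (⟨p, X p⟩ : TangentBundle 𝓘(ℝ, H) N)) U

variable (H N) in
/-- A field of linear subspaces of the tangent spaces of `N`. -/
abbrev SubspaceField := (p : N) → Submodule ℝ (TangentSpace 𝓘(ℝ, H) p)

namespace SubspaceField

/-- `D` is a `k`-dimensional distribution on `N`, that is, a smooth rank `k` subbundle of `TN`:
it is locally spanned by `k` linearly independent smooth vector fields. -/
def IsDistribution [IsManifold 𝓘(ℝ, H) ∞ N] (k : ℕ) (D : SubspaceField H N) : Prop :=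
  ∀ p : N, ∃ U : Set N, IsOpen U ∧ p ∈ U ∧
    ∃ X : Fin k → (q : N) → TangentSpace 𝓘(ℝ, H) q,
      (∀ i, IsSmoothVectorFieldOn (X i) U) ∧
      ∀ q ∈ U, LinearIndependent ℝ (fun i => X i q) ∧
        Submodule.span ℝ (Set.range fun i => X i q) = D q

end SubspaceField

variable (B H) in
/-- `s` is a smooth local section, with domain the open set `U`, of `p : N → M`. -/
structure IsLocalSection (p : N → M) (U : Set M) (s : M → N) : Prop where
  isOpen : IsOpen U
  contMDiffOn : ContMDiffOn 𝓘(ℝ, B) 𝓘(ℝ, H) ∞ s U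
  proj_eq : ∀ x ∈ U, p (s x) = x

variable (B) in
/-- `s : U → N` is an integral section of `D`: a local section of `p` such that
`T_q (Im s) = D_q` at every `q ∈ Im s`. -/
def IsIntegralSection (p : N → M) (D : SubspaceField H N) (U : Set M) (s : M → N) : Prop :=
  IsLocalSection B H p U s ∧
    ∀ x ∈ U, (mfderiv 𝓘(ℝ, B) 𝓘(ℝ, H) s x).range = D (s x)

variable (B) in
/-- Integrability of a distribution transverse to the fibres of `p` (so that its integral manifolds
are local sections of `p`): there is an integral section through every point. -/
def IsIntegrableDistribution (p : N → M) (D : SubspaceField H N) : Prop :=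
  ∀ q : N, ∃ (U : Set M) (s : M → N), IsIntegralSection B p D U s ∧ ∃ x ∈ U, s x = q

end Distributions

section Orthogonality

variable {V : Type*} [AddCommGroup V] [Module ℝ V] [TopologicalSpace V]

/-- The `l`-th orthogonal complement of a subspace `W`, with respect to an `(l+1)`-form. -/
def orthogonalComplement {l : ℕ} (α : V [⋀^Fin (l + 1)]→L[ℝ] ℝ) (W : Submodule ℝ V) : Set V :=
  {u | ∀ v : Fin l → V, (∀ i, v i ∈ W) → α (Fin.cons u v) = 0}

/-- `W` is `l`-Lagrangian with respect to an `(l+1)`-form. -/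
def IsLagrangianSubspace {l : ℕ} (α : V [⋀^Fin (l + 1)]→L[ℝ] ℝ) (W : Submodule ℝ V) : Prop :=
  (W : Set V) = orthogonalComplement α W

end Orthogonality

section Insertion

variable {T B W : Type*} [NormedAddCommGroup T] [NormedSpace ℝ T]
  [NormedAddCommGroup B] [NormedSpace ℝ B] [FiniteDimensional ℝ B]
  [NormedAddCommGroup W] [NormedSpace ℝ W]

/-- The `m`-form `v ↦ ∑ₖ ℓ (X ↦ η (τ v₁, …, X, …, τ vₘ) θ(vₖ))`, with `X` in the `k`-th place. -/
def insertionForm {m : ℕ} (η : B [⋀^Fin m]→L[ℝ] ℝ) (τ : T →L[ℝ] B) (θ : T →L[ℝ] W)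
    (ℓ : (B →L[ℝ] W) →L[ℝ] ℝ) : T [⋀^Fin m]→L[ℝ] ℝ where
  toFun v := ∑ k, ℓ ((η.toContinuousLinearMap (τ ∘ v) k).smulRight (θ (v k)))
  map_update_add' := by
    intro dec v i x y
    obtain rfl : dec = instDecidableEqFin m := Subsingleton.elim _ _
    rw [← Finset.sum_add_distrib]
    refine Finset.sum_congr rfl fun k _ => ?_
    rw [← map_add]
    congr 1
    ext X
    by_cases hk : k = i
    · subst hk
      simp [Function.comp_update, ContinuousAlternatingMap.toContinuousLinearMap, smul_add]
    · have hc : ∀ z, Function.update (Function.update (τ ∘ v) i z) k X =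
          Function.update (Function.update (τ ∘ v) k X) i z :=
        fun z => Function.update_comm (fun h => hk h.symm) _ _ _
      have h1 : ∀ z, η.toContinuousLinearMap (Function.update (τ ∘ v) i z) k X =
          η (Function.update (Function.update (τ ∘ v) k X) i z) := fun z => congrArg η (hc z)
      simp only [Function.comp_update, ContinuousLinearMap.smulRight_apply, h1, map_add,
        Function.update_of_ne hk, add_apply, η.map_update_add, add_smul]
  map_update_smul' := by
    intro dec v i c x
    obtain rfl : dec = instDecidableEqFin m := Subsingleton.elim _ _
    rw [Finset.smul_sum]
    refine Finset.sum_congr rfl fun k _ => ?_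
    rw [← map_smul]
    congr 1
    ext X
    by_cases hk : k = i
    · subst hk
      simp [Function.comp_update, ContinuousAlternatingMap.toContinuousLinearMap, smul_comm c]
    · have hc : ∀ z, Function.update (Function.update (τ ∘ v) i z) k X =
          Function.update (Function.update (τ ∘ v) k X) i z :=
        fun z => Function.update_comm (fun h => hk h.symm) _ _ _
      have h1 : ∀ z, η.toContinuousLinearMap (Function.update (τ ∘ v) i z) k X =
          η (Function.update (Function.update (τ ∘ v) k X) i z) := fun z => congrArg η (hc z)
      simp only [Function.comp_update, ContinuousLinearMap.smulRight_apply, h1, map_smul,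
        Function.update_of_ne hk, smul_apply, η.map_update_smul, mul_smul, smul_eq_mul]
  map_eq_zero_of_eq' := by
    intro v i j hv hij
    have h0 : ∀ k, k ≠ i → k ≠ j →
        (η.toContinuousLinearMap (τ ∘ v) k).smulRight (θ (v k)) = 0 := by
      intro k hki hkj
      ext X
      have : η (Function.update (τ ∘ v) k X) = 0 := by
        refine η.map_eq_zero_of_eq _ (i := i) (j := j) ?_ hij
        rw [Function.update_of_ne hki.symm, Function.update_of_ne hkj.symm]
        simp [hv]
      simp [ContinuousAlternatingMap.toContinuousLinearMap, this]
    have h1 : (η.toContinuousLinearMap (τ ∘ v) j).smulRight (θ (v j)) =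
        -(η.toContinuousLinearMap (τ ∘ v) i).smulRight (θ (v i)) := by
      ext X
      have h2 : Function.update (τ ∘ v) j X = Function.update (τ ∘ v) i X ∘ Equiv.swap i j := by
        funext k
        by_cases hki : k = i
        · subst hki
          simp [hij, Function.update_of_ne hij.symm, hv]
        · by_cases hkj : k = j
          · subst hkj
            simp
          · simp [Equiv.swap_apply_of_ne_of_ne hki hkj, hki, hkj]
      have h3 : η (Function.update (τ ∘ v) j X) = -η (Function.update (τ ∘ v) i X) := by
        rw [h2]
        exact η.toAlternatingMap.map_swap _ hij
      simp [ContinuousAlternatingMap.toContinuousLinearMap, h3, hv]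
    change ∑ k, ℓ ((η.toContinuousLinearMap (τ ∘ v) k).smulRight (θ (v k))) = 0
    rw [Finset.sum_eq_add i j hij (fun k _ hk => by rw [h0 k hk.1 hk.2, map_zero]) (by simp)
      (by simp), h1, map_neg, add_neg_cancel]
  cont := by
    refine continuous_finsetSum _ fun k _ => ℓ.continuous.comp ?_
    rw [continuous_clm_apply]
    intro X
    have h : Continuous fun v : Fin m → T => η (Function.update (τ ∘ v) k X) :=
      η.cont.comp ((continuous_pi fun i => τ.continuous.comp (continuous_apply i)).update k
        continuous_const)
    exact h.smul (θ.continuous.comp (continuous_apply k))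

end Insertion

section LagrangianFieldTheory

variable {B F M E : Type*}
  [NormedAddCommGroup B] [NormedSpace ℝ B] [FiniteDimensional ℝ B]
  [NormedAddCommGroup F] [NormedSpace ℝ F]
  [TopologicalSpace M] [ChartedSpace B M] [IsManifold 𝓘(ℝ, B) ∞ M]
  [TopologicalSpace E] [ChartedSpace (B × F) E] [IsManifold 𝓘(ℝ, B × F) ∞ E]

variable (B F) in
/-- The model space of `J¹π`, with coordinates `(x, u, uᵢ)`. -/
abbrev JetModel := (B × F) × (B →L[ℝ] F)

/-- The tangent map `T_uπ`. -/
def SmoothBundle.dProj (π : SmoothBundle B F M E) (u : E) : B × F →L[ℝ] B :=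
  mfderiv 𝓘(ℝ, B × F) 𝓘(ℝ, B) π.proj u

/-- The vertical space `V_uπ = ker T_uπ`. -/
def SmoothBundle.vertical (π : SmoothBundle B F M E) (u : E) : Submodule ℝ (B × F) :=
  (π.dProj u).ker

namespace FirstJet

variable {π : SmoothBundle B F M E}

/-- The projection `J¹π → M`. -/
def projBase (j : FirstJet π) : M := π.proj j.pt

/-- The tangent map of `J¹π → E` at `j`. -/
def dPt (j : FirstJet π) : JetModel B F →L[ℝ] B × F :=
  mfderiv 𝓘(ℝ, JetModel B F) 𝓘(ℝ, B × F) (FirstJet.pt (π := π)) j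

/-- The tangent map of `J¹π → M` at `j`. -/
def dProjBase (j : FirstJet π) : JetModel B F →L[ℝ] B :=
  mfderiv 𝓘(ℝ, JetModel B F) 𝓘(ℝ, B) (FirstJet.projBase (π := π)) j

/-- The linear map `T_{π u}M → T_uE` given by a jet `j` over `u`. -/
def horMap (j : FirstJet π) : B →L[ℝ] B × F := j.hor

theorem dProj_horMap (j : FirstJet π) (v : B) : π.dProj j.pt (j.horMap v) = v := j.mfderiv_hor v

/-- The affine structure of the fibre `J¹_uπ`, modelled on `Hom(T_{π u}M, V_uπ)`. -/
def translate (j : FirstJet π) (φ : B →L[ℝ] π.vertical j.pt) : FirstJet π where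
  pt := j.pt
  hor := (j.horMap + (π.vertical j.pt).subtypeL ∘L φ : B →L[ℝ] B × F)
  mfderiv_hor v := by
    have h2 : π.dProj j.pt (φ v : B × F) = 0 := (φ v).2
    have h3 : ∀ w : B, π.dProj j.pt (φ w : B × F) = 0 →
        π.dProj j.pt (j.horMap w + (φ w : B × F)) = w := by
      intro w hw
      rw [map_add, j.dProj_horMap, hw, add_zero]
    exact h3 v h2

/-- The canonical structure form `θ_j(v) = (Id - T(φ ∘ π))(Tπ¹ v)`, where `j = j¹ₓφ`. -/
def structureForm (j : FirstJet π) : JetModel B F →L[ℝ] π.vertical j.pt :=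
  (j.dPt - j.horMap ∘L π.dProj j.pt ∘L j.dPt).codRestrict (π.vertical j.pt) fun v => by
    have h2 : π.dProj j.pt (j.dPt v - j.horMap (π.dProj j.pt (j.dPt v))) = 0 := by
      rw [map_sub, j.dProj_horMap, sub_self]
    exact h2

/-- The 1-jet `j¹ₓφ` of a local section `φ` of `π` at a point `x` of its domain. -/
def prolongation {φ : M → E} {U : Set M} (hφ : IsLocalSection B (B × F) π.proj U φ)
    {x : M} (hx : x ∈ U) : FirstJet π where
  pt := φ x
  hor := (mfderiv 𝓘(ℝ, B) 𝓘(ℝ, B × F) φ x : B →L[ℝ] B × F)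
  mfderiv_hor v := by
    have hφx : MDifferentiableAt 𝓘(ℝ, B) 𝓘(ℝ, B × F) φ x :=
      (hφ.contMDiffOn.contMDiffAt (hφ.isOpen.mem_nhds hx)).mdifferentiableAt (by simp)
    have h := mfderiv_comp x (π.mdifferentiableAt (φ x)) hφx
    have h' : (π.proj ∘ φ) =ᶠ[𝓝 x] id := by
      filter_upwards [hφ.isOpen.mem_nhds hx] with y hy using hφ.proj_eq y hy
    rw [h'.mfderiv_eq, mfderiv_id] at h
    exact (DFunLike.congr_fun h v).symm

end FirstJet

variable {π : SmoothBundle B F M E}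

/-- The vertical derivative of the Lagrangian function `L` at `j ∈ J¹_uπ`: the derivative at `j` of
the restriction of `L` to the affine space `J¹_uπ`. -/
def verticalDeriv (L : FirstJet π → ℝ) (j : FirstJet π) :
    (B →L[ℝ] π.vertical j.pt) →L[ℝ] ℝ :=
  fderiv ℝ (fun φ => L (j.translate φ)) 0

/-- The Hessian at `j` of the restriction of `L` to the affine space `J¹_uπ`; its matrix is
`(∂²L / ∂uᵢ^α ∂uⱼ^β)`. -/
def verticalHessian (L : FirstJet π → ℝ) (j : FirstJet π) :
    (B →L[ℝ] π.vertical j.pt) →L[ℝ] (B →L[ℝ] π.vertical j.pt) →L[ℝ] ℝ :=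
  fderiv ℝ (fderiv ℝ (fun φ => L (j.translate φ))) 0

/-- Regularity of the Lagrangian: its Hessian in the derivative variables is nondegenerate. -/
def IsRegularLagrangian (L : FirstJet π → ℝ) : Prop :=
  ∀ (j : FirstJet π) (φ : B →L[ℝ] π.vertical j.pt),
    (∀ χ, verticalHessian L j φ χ = 0) → φ = 0

/-- The Lagrangian density `𝓛 = L (π̄¹)^*η`, a semibasic `m`-form on `J¹π`. -/
def lagrangianDensity {m : ℕ} (η : DiffForm B M m) (L : FirstJet π → ℝ) (j : FirstJet π) :
    JetModel B F [⋀^Fin m]→L[ℝ] ℝ :=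
  L j • (η j.projBase).compContinuousLinearMap j.dProjBase

/-- The Cartan `m`-form `Θ_𝓛 = i(ν)d𝓛 + 𝓛`, where `ν` is the canonical vertical endomorphism. The
first term is `v ↦ ∑ₖ d^vL (X ↦ η(Tπ̄¹ v₁, …, X, …, Tπ̄¹ vₘ) θ(vₖ))`, in coordinates
`∂L/∂uᵢ^α (du^α - uⱼ^α dx^j) ∧ i(∂/∂x^i)η`. -/
def cartanForm {m : ℕ} (η : DiffForm B M m) (L : FirstJet π → ℝ) :
    DiffForm (JetModel B F) (FirstJet π) m := fun j =>
  insertionForm (T := JetModel B F) (B := B) (η j.projBase) j.dProjBase j.structureForm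
    (verticalDeriv L j) + lagrangianDensity η L j

/-- The Cartan `(m+1)`-form `Ω_𝓛 = -dΘ_𝓛`. -/
def multisymplecticCartanForm {m : ℕ} (η : DiffForm B M m) (L : FirstJet π → ℝ) :
    DiffForm (JetModel B F) (FirstJet π) (m + 1) := fun j =>
  -(cartanForm η L).extDeriv j

/-- `D` is a solution `D_𝓛` of the Lagrangian problem: an `m`-dimensional, integrable distribution
in `J¹π`, transverse to `J¹π → M`, whose integral sections are prolongations `j¹φ` of sections `φ`
of `π` that satisfy `(j¹φ)^* i(X) Ω_𝓛 = 0` for every vector field `X` on `J¹π`. -/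
structure IsLagrangianDistribution {m : ℕ} (η : DiffForm B M m) (L : FirstJet π → ℝ)
    (D : SubspaceField (JetModel B F) (FirstJet π)) : Prop where
  isDistribution : D.IsDistribution m
  transverse : ∀ j : FirstJet π, Disjoint (D j) j.dProjBase.ker
  integrable : IsIntegrableDistribution B FirstJet.projBase D
  isProlongation : ∀ (U : Set M) (ψ : M → FirstJet π),
    IsIntegralSection B FirstJet.projBase D U ψ →
      ∃ (φ : M → E) (hφ : IsLocalSection B (B × F) π.proj U φ),
        ∀ x (hx : x ∈ U), ψ x = FirstJet.prolongation hφ hx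
  fieldEquation : ∀ (U : Set M) (ψ : M → FirstJet π),
    IsIntegralSection B FirstJet.projBase D U ψ →
      ∀ X : (j : FirstJet π) → TangentSpace 𝓘(ℝ, JetModel B F) j,
        IsSmoothVectorFieldOn X Set.univ → ∀ x ∈ U, ∀ v : Fin m → TangentSpace 𝓘(ℝ, B) x,
          multisymplecticCartanForm η L (ψ x) (Fin.cons (X (ψ x))
            fun i => mfderiv 𝓘(ℝ, B) 𝓘(ℝ, JetModel B F) ψ x (v i)) = 0

/-- A jet field: a smooth global section of `J¹π → E`. -/
structure JetField (π : SmoothBundle B F M E) where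
  toFun : E → FirstJet π
  contMDiff : ContMDiff 𝓘(ℝ, B × F) 𝓘(ℝ, JetModel B F) ∞ toFun
  pt_toFun : ∀ u, (toFun u).pt = u

namespace JetField

variable (Ψ : JetField π)

/-- The distribution `D(Ψ)` in `E` associated with the jet field: the horizontal subspaces. -/
def distribution : SubspaceField (B × F) E := fun u =>
  (Ψ.toFun u).horMap.range

/-- `Ψ` is integrable if `D(Ψ)` is. -/
def IsIntegrable : Prop := IsIntegrableDistribution B π.proj Ψ.distribution

/-- The tangent map of `Ψ` at `u`; its range is the tangent space of `Im Ψ` at `Ψ(u)`. -/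
def tangentMap (u : E) : B × F →L[ℝ] JetModel B F :=
  mfderiv 𝓘(ℝ, B × F) 𝓘(ℝ, JetModel B F) Ψ.toFun u

/-- The pullback `Ψ^*α`. -/
def pullback {k : ℕ} (α : DiffForm (JetModel B F) (FirstJet π) k) : DiffForm (B × F) E k :=
  fun u => (α (Ψ.toFun u)).compContinuousLinearMap (Ψ.tangentMap u)

/-- The distribution `Tπ¹(D|_{Im Ψ})` in `E`. -/
def associated (D : SubspaceField (JetModel B F) (FirstJet π)) : SubspaceField (B × F) E :=
  fun u => (D (Ψ.toFun u)).map ((Ψ.toFun u).dPt : JetModel B F →ₗ[ℝ] B × F)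

/-- `Ψ` is a solution of the generalized Lagrangian Hamilton-Jacobi problem: it is integrable, and
`Ψ ∘ γ` is an integral section of `D` whenever `γ` is an integral section of the `m`-dimensional
and integrable distribution `Tπ¹(D|_{Im Ψ})`. -/
structure IsGeneralizedSolution (m : ℕ) (D : SubspaceField (JetModel B F) (FirstJet π)) :
    Prop where
  integrable : Ψ.IsIntegrable
  associated_isDistribution : (Ψ.associated D).IsDistribution m
  associated_integrable : IsIntegrableDistribution B π.proj (Ψ.associated D)
  comp_isIntegralSection : ∀ (U : Set M) (γ : M → E),
    IsIntegralSection B π.proj (Ψ.associated D) U γ →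
      IsIntegralSection B FirstJet.projBase D U (Ψ.toFun ∘ γ)

/-- `Ψ` is a solution of the Lagrangian Hamilton-Jacobi problem: a solution of the generalized
problem with `Ψ^*Ω_𝓛 = 0`. -/
def IsSolution {m : ℕ} (η : DiffForm B M m) (L : FirstJet π → ℝ)
    (D : SubspaceField (JetModel B F) (FirstJet π)) : Prop :=
  Ψ.IsGeneralizedSolution m D ∧ Ψ.pullback (multisymplecticCartanForm η L) = 0

/-- The submanifold `Im Ψ` is `l`-Lagrangian with respect to an `(l+1)`-form. -/
def IsLagrangianImage {l : ℕ} (α : DiffForm (JetModel B F) (FirstJet π) (l + 1)) : Prop :=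
  ∀ u : E, IsLagrangianSubspace (α (Ψ.toFun u)) (Ψ.tangentMap u).range

/-- The distribution `D` is tangent to the submanifold `Im Ψ`. -/
def IsTangentToImage (D : SubspaceField (JetModel B F) (FirstJet π)) : Prop :=
  ∀ u : E, D (Ψ.toFun u) ≤ (Ψ.tangentMap u).range

/-- `ψ` is an integral section of `D`, with a connected domain `U`, that satisfies a boundary
condition in `Im Ψ`, that is, passes through some point of `Im Ψ`. -/
def IsIntegralSectionMeetingImage (D : SubspaceField (JetModel B F) (FirstJet π)) (U : Set M)
    (ψ : M → FirstJet π) : Prop :=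
  IsConnected U ∧ IsIntegralSection B FirstJet.projBase D U ψ ∧
    ∃ x ∈ U, ψ x ∈ Set.range Ψ.toFun

/-- The integral sections of `D` with boundary conditions in `Im Ψ` project onto the integral
sections of `Tπ¹(D|_{Im Ψ})` (on connected domains): each of the former projects to one of the
latter, and each of the latter is obtained in this way. -/
def ProjectsOntoIntegralSections (D : SubspaceField (JetModel B F) (FirstJet π)) : Prop :=
  (∀ (U : Set M) (ψ : M → FirstJet π), Ψ.IsIntegralSectionMeetingImage D U ψ →
    IsIntegralSection B π.proj (Ψ.associated D) U (fun x => (ψ x).pt)) ∧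
  ∀ (U : Set M) (γ : M → E), IsConnected U →
    IsIntegralSection B π.proj (Ψ.associated D) U γ →
      ∃ ψ : M → FirstJet π, Ψ.IsIntegralSectionMeetingImage D U ψ ∧ ∀ x ∈ U, (ψ x).pt = γ x

end JetField

end LagrangianFieldTheory

end

/-! Everything reduces to the tangency of `D` to Im Ψ. Integral sections of `D` are prolongations,
so the projection of `D j` to E is the horizontal space of the jet `j` itself. Hence Tπ¹(D|Im Ψ) is
the distribution D(Ψ) (`associated_eq_distribution`); it is automatically m-dimensional and, since Ψ
is integrable, integrable. What remains in statement 1 is that Ψ ∘ γ is an integral section of `D`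
for each integral section γ of D(Ψ).

The Lagrangian condition in statement 2 is automatic as well. Let F be the tangent space of Im Ψ.
That F lies in its m-orthogonal is Ψ^*Ω = 0. For the converse, T J¹π splits along Im Ψ as F ⊕ ker
Tπ¹, so it suffices that a vector ξ of ker Tπ¹ with Ω(ξ, v₁, …, vₘ) = 0 for all vᵢ in F is zero. In
coordinates ξ = (0, q). If one of the vᵢ is vertical over M, then Ω(ξ, v₁, …, vₘ) is, up to sign,
the Hessian of L paired with q and a rank-one map B → F. Such maps span all of Hom(B, F), and
regularity gives q = 0 (`eq_zero_of_multisymplecticCartanForm_eq_zero`).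

1 → 2: the space tangent to an integral section Ψ ∘ γ is `D`, and it lies in T(Im Ψ).

2 → 3: by tangency, Ψ ∘ γ is an integral section of `D` lying over γ. Conversely, an integral
section of `D` that meets Im Ψ stays in it. Locally this is a Grönwall estimate and needs no
Frobenius theorem: in a chart, let P be the retraction Ψ ∘ π¹ onto Im Ψ. A frame of `D` is tangent
to Im Ψ along it, hence tangent nearby up to an error of order ‖z - P z‖, so the deviation of a
section from its retraction satisfies a linear differential inequality with zero initial value
(`eventually_retraction_eq_of_tangent`). Connectedness of the domain makes this global.

3 → 1: locally γ = π¹ ∘ ψ with ψ an integral section of `D`. Then ψ = j¹γ because ψ is a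
prolongation, and Ψ ∘ γ = j¹γ because γ is an integral section of D(Ψ). So Ψ ∘ γ = ψ locally. -/

noncomputable section

/-! ### Estimates for retractions and frames, and alternating forms, on normed spaces. -/

section NormedSpaces

variable {B H : Type*} [NormedAddCommGroup B] [NormedSpace ℝ B]
  [NormedAddCommGroup H] [NormedSpace ℝ H]

/-- A family of vectors that depends continuously on a parameter and is linearly independent at
`z₀` bounds the coefficients of linear combinations uniformly near `z₀`. -/
theorem LinearIndependent.eventually_norm_le_mul_norm_sum {Z : Type*} [TopologicalSpace Z]
    {k : ℕ} {X : Fin k → Z → H} {z₀ : Z}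
    (hX : ∀ i, ContinuousAt (X i) z₀) (hli : LinearIndependent ℝ fun i => X i z₀) :
    ∃ C : ℝ, 0 ≤ C ∧ ∀ᶠ z in 𝓝 z₀, ∀ a : Fin k → ℝ, ‖a‖ ≤ C * ‖∑ i, a i • X i z‖ := by
  let A : Z → (Fin k → ℝ) →L[ℝ] H := fun z =>
    ∑ i, (ContinuousLinearMap.proj (R := ℝ) (φ := fun _ : Fin k => ℝ) i).smulRight (X i z)
  have hA : ∀ z a, A z a = ∑ i, a i • X i z := fun z a => by simp [A]
  have hAc : ContinuousAt A z₀ :=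
    tendsto_finsetSum _ fun i _ =>
      ((ContinuousLinearMap.smulRightL ℝ (Fin k → ℝ) H
        (ContinuousLinearMap.proj i)).continuous.tendsto _).comp (hX i)
  have hinj : LinearMap.ker (A z₀ : (Fin k → ℝ) →ₗ[ℝ] H) = ⊥ := by
    rw [LinearMap.ker_eq_bot']
    intro a ha
    have ha' : ∑ i, a i • X i z₀ = 0 := by rw [← hA]; exact ha
    exact funext (Fintype.linearIndependent_iff.1 hli a ha')
  obtain ⟨c, hc, hanti⟩ := LinearMap.exists_antilipschitzWith (A z₀ : (Fin k → ℝ) →ₗ[ℝ] H) hinj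
  have hbound : ∀ a, ‖a‖ ≤ c * ‖A z₀ a‖ := fun a => by
    simpa using hanti.le_mul_norm (map_zero _) a
  have hcpos : (0 : ℝ) < c := hc
  -- Near `z₀` the operator moves by less than 1/(2c), which costs at most ‖a‖/2 in the bound for `A
  -- z₀`; hence the factor 2.
  refine ⟨2 * c, by positivity, ?_⟩
  have hclose : ∀ᶠ z in 𝓝 z₀, ‖A z - A z₀‖ < 1 / (2 * c) := by
    have h := (hAc.sub (continuousAt_const (y := A z₀))).norm
    have h0 : (fun z => ‖A z - A z₀‖) z₀ < 1 / (2 * (c : ℝ)) := by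
      simp only [sub_self, norm_zero]; positivity
    exact h.eventually (gt_mem_nhds h0)
  filter_upwards [hclose] with z hz a
  rw [← hA]
  have h1 : ‖A z₀ a‖ ≤ ‖A z a‖ + ‖A z - A z₀‖ * ‖a‖ := by
    have h2 : A z₀ a = A z a - (A z - A z₀) a := by simp
    rw [h2]
    exact (norm_sub_le _ _).trans (add_le_add_right ((A z - A z₀).le_opNorm a) _)
  have h3 : ‖A z - A z₀‖ * ‖a‖ ≤ 1 / (2 * c) * ‖a‖ := by gcongr
  have h4 : ‖a‖ ≤ c * (‖A z a‖ + 1 / (2 * c) * ‖a‖) :=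
    (hbound a).trans (by gcongr; linarith)
  have h5 : c * (1 / (2 * c) * ‖a‖) = ‖a‖ / 2 := by field_simp
  rw [mul_add, h5] at h4
  linarith

/-- If `P` is a retraction onto a submanifold and the vector fields `X i` are tangent to the
submanifold along it, they are almost tangent to it nearby. -/
theorem exists_norm_sub_fderiv_le_of_retraction {k : ℕ} {P : H → H} {X : Fin k → H → H} {z₀ : H}
    (hP : ContDiffAt ℝ ∞ P z₀) (hPz₀ : P z₀ = z₀) (hPP : ∀ᶠ z in 𝓝 z₀, P (P z) = P z)
    (hX : ∀ i, ContDiffAt ℝ ∞ (X i) z₀) (hli : LinearIndependent ℝ fun i => X i z₀)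
    (hPX : ∀ᶠ z in 𝓝 z₀, P z = z → ∀ i, fderiv ℝ P z (X i z) = X i z) :
    ∃ C : ℝ, 0 ≤ C ∧ ∀ᶠ z in 𝓝 z₀, ∀ w ∈ Submodule.span ℝ (Set.range fun i => X i z),
      ‖w - fderiv ℝ P z w‖ ≤ C * ‖w‖ * ‖z - P z‖ := by
  -- The defect of tangency is C¹, hence Lipschitz near `z₀`, and it vanishes at `P z`; comparing
  -- `z` with `P z` bounds it by a multiple of ‖z - P z‖.
  have hg : ∀ i, ContDiffAt ℝ 1 (fun z => X i z - fderiv ℝ P z (X i z)) z₀ := fun i =>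
    ((hX i).of_le (by simp)).sub
      ((hP.fderiv_right (m := 1) (by norm_cast)).clm_apply ((hX i).of_le (by simp)))
  choose K t ht hK using fun i => (hg i).exists_lipschitzOnWith
  have hPc : Filter.Tendsto P (𝓝 z₀) (𝓝 z₀) := by
    have := hP.continuousAt.tendsto
    rwa [hPz₀] at this
  obtain ⟨C, hC, hcoef⟩ := LinearIndependent.eventually_norm_le_mul_norm_sum
    (fun i => (hX i).continuousAt) hli
  refine ⟨C * ∑ i, (K i : ℝ), by positivity, ?_⟩
  filter_upwards [hcoef, hPP, hPc.eventually hPX,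
    (Filter.eventually_all.2 ht : ∀ᶠ z in 𝓝 z₀, ∀ i, z ∈ t i),
    hPc.eventually (Filter.eventually_all.2 ht : ∀ᶠ z in 𝓝 z₀, ∀ i, z ∈ t i)]
    with z hz hPPz hPXz htz htPz w hw
  obtain ⟨a, rfl⟩ := (Submodule.mem_span_range_iff_exists_fun ℝ).1 hw
  have h1 : ∀ i, ‖X i z - fderiv ℝ P z (X i z)‖ ≤ K i * ‖z - P z‖ := fun i => by
    have h2 := (hK i).norm_sub_le (htz i) (htPz i)
    rwa [hPXz hPPz i, sub_self, sub_zero] at h2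
  have h3 : ∑ i, a i • X i z - fderiv ℝ P z (∑ i, a i • X i z) =
      ∑ i, a i • (X i z - fderiv ℝ P z (X i z)) := by
    simp [map_sum, smul_sub, Finset.sum_sub_distrib]
  rw [h3]
  calc ‖∑ i, a i • (X i z - fderiv ℝ P z (X i z))‖
      ≤ ∑ i, ‖a‖ * (K i * ‖z - P z‖) := by
        refine norm_sum_le_of_le _ fun i _ => ?_
        rw [norm_smul]
        exact mul_le_mul (norm_le_pi_norm a i) (h1 i) (norm_nonneg _) (norm_nonneg _)
    _ = ‖a‖ * ((∑ i, (K i : ℝ)) * ‖z - P z‖) := by rw [← Finset.mul_sum, Finset.sum_mul]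
    _ ≤ (C * ‖∑ i, a i • X i z‖) * ((∑ i, (K i : ℝ)) * ‖z - P z‖) := by
        gcongr
        exact hz a
    _ = _ := by ring

/-- A map through a point of the image of the retraction `P`, everywhere tangent to a frame that is
tangent to this image along it, stays in the image. -/
theorem eventually_retraction_eq_of_tangent {k : ℕ} {P : H → H} {X : Fin k → H → H} {z₀ : H}
    {f : B → H} {x₀ : B}
    (hP : ContDiffAt ℝ ∞ P z₀) (hPz₀ : P z₀ = z₀) (hPP : ∀ᶠ z in 𝓝 z₀, P (P z) = P z)
    (hX : ∀ i, ContDiffAt ℝ ∞ (X i) z₀) (hli : LinearIndependent ℝ fun i => X i z₀)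
    (hPX : ∀ᶠ z in 𝓝 z₀, P z = z → ∀ i, fderiv ℝ P z (X i z) = X i z)
    (hf : ContDiffAt ℝ ∞ f x₀) (hf₀ : f x₀ = z₀)
    (hfX : ∀ᶠ x in 𝓝 x₀, ∀ v, fderiv ℝ f x v ∈
      Submodule.span ℝ (Set.range fun i => X i (f x))) :
    ∀ᶠ x in 𝓝 x₀, P (f x) = f x := by
  obtain ⟨C, hC, hbound⟩ := exists_norm_sub_fderiv_le_of_retraction hP hPz₀ hPP hX hli hPX
  have hfc : Filter.Tendsto f (𝓝 x₀) (𝓝 z₀) := by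
    have := hf.continuousAt.tendsto
    rwa [hf₀] at this
  have hPd : ∀ᶠ z in 𝓝 z₀, DifferentiableAt ℝ P z :=
    (hP.of_le (m := 1) (by simp)).eventually (by simp) |>.mono
      fun z hz => hz.differentiableAt (by simp)
  have hfd : ∀ᶠ x in 𝓝 x₀, DifferentiableAt ℝ f x :=
    (hf.of_le (m := 1) (by simp)).eventually (by simp) |>.mono
      fun z hz => hz.differentiableAt (by simp)
  have hfb : ∀ᶠ x in 𝓝 x₀, ‖fderiv ℝ f x‖ < ‖fderiv ℝ f x₀‖ + 1 :=
    ((hf.fderiv_right (m := 0) (by simp)).continuousAt.norm).eventually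
      (gt_mem_nhds (lt_add_one _))
  obtain ⟨r, hr, hball⟩ := Metric.eventually_nhds_iff_ball.1
    ((hfc.eventually (hbound.and hPd)).and (hfd.and (hfb.and hfX)))
  filter_upwards [Metric.ball_mem_nhds x₀ hr] with x hx
  set N := ‖fderiv ℝ f x₀‖ + 1
  have hmem : ∀ t ∈ Set.Icc (0 : ℝ) 1, x₀ + t • (x - x₀) ∈ Metric.ball x₀ r := fun t ht =>
    (convex_ball x₀ r).add_smul_sub_mem (Metric.mem_ball_self hr) hx ht
  -- The deviation from the image of `P` along the segment from `x₀` to `x`. The bound on `w - DP w`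
  -- gives ‖c'‖ ≤ C ‖w‖ ‖c‖, and ‖w‖ ≤ N ‖x - x₀‖ on the ball, so Grönwall's inequality applies.
  let c : ℝ → H := fun t => f (x₀ + t • (x - x₀)) - P (f (x₀ + t • (x - x₀)))
  let w : ℝ → H := fun t => fderiv ℝ f (x₀ + t • (x - x₀)) (x - x₀)
  have hc : ∀ t ∈ Set.Icc (0 : ℝ) 1,
      HasDerivAt c (w t - fderiv ℝ P (f (x₀ + t • (x - x₀))) (w t)) t := by
    intro t ht
    obtain ⟨⟨-, h1⟩, h2, -, -⟩ := hball _ (hmem t ht)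
    have h3 : HasDerivAt (fun t : ℝ => x₀ + t • (x - x₀)) (x - x₀) t := by
      simpa using ((hasDerivAt_id t).smul_const (x - x₀)).const_add x₀
    have h4 : HasDerivAt (fun t : ℝ => f (x₀ + t • (x - x₀))) (w t) t :=
      h2.hasFDerivAt.comp_hasDerivAt t h3
    exact h4.sub (h1.hasFDerivAt.comp_hasDerivAt t h4)
  have h0 : c 0 = 0 := by simp [c, hf₀, hPz₀]
  have h1 : c 1 = 0 := by
    refine eq_zero_of_abs_deriv_le_mul_abs_self_of_eq_zero_right (a := 0) (b := 1)
      (K := C * (N * ‖x - x₀‖))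
      (fun t ht => (hc t ht).continuousAt.continuousWithinAt)
      (fun t ht => (hc t ⟨ht.1, ht.2.le⟩).hasDerivWithinAt) h0 ?_ 1 (by simp)
    intro t ht
    obtain ⟨⟨h1, -⟩, -, h3, h4⟩ := hball _ (hmem t ⟨ht.1, ht.2.le⟩)
    refine (h1 _ (h4 (x - x₀))).trans ?_
    have h5 : ‖w t‖ ≤ N * ‖x - x₀‖ :=
      (ContinuousLinearMap.le_opNorm _ _).trans (by gcongr)
    gcongr
  have h2 : f x - P (f x) = 0 := by simpa [c] using h1
  exact (sub_eq_zero.1 h2).symm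

/-- On a finite-dimensional space, differentiability of a family of alternating forms can be checked
on vectors. -/
theorem ContinuousAlternatingMap.differentiableAt_of_apply [FiniteDimensional ℝ H] {Z : Type*}
    [NormedAddCommGroup Z] [NormedSpace ℝ Z] {m : ℕ} {β : Z → H [⋀^Fin m]→L[ℝ] ℝ} {z : Z}
    (h : ∀ v : Fin m → H, DifferentiableAt ℝ (fun z => β z v) z) : DifferentiableAt ℝ β z := by
  let b := Module.finBasis ℝ H
  -- A form is determined by its values on tuples of basis vectors, so `ev` has a linear left
  -- inverse, continuous by finite dimension, and `β` factors through finitely many scalar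
  -- functions.
  let ev : (H [⋀^Fin m]→L[ℝ] ℝ) →ₗ[ℝ] (Fin m → Fin (Module.finrank ℝ H)) → ℝ :=
    { toFun := fun α σ => α fun i => b (σ i)
      map_add' := fun _ _ => rfl
      map_smul' := fun _ _ => rfl }
  have hker : ev.ker = ⊥ := by
    rw [LinearMap.ker_eq_bot']
    intro α hα
    apply ContinuousAlternatingMap.toAlternatingMap_injective
    exact b.ext_alternating fun σ _ => congrFun hα σ
  obtain ⟨g, hg⟩ := ev.exists_leftInverse_of_injective hker
  have h1 : β = fun z => g.toContinuousLinearMap (ev (β z)) := by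
    funext z
    exact (LinearMap.congr_fun hg (β z)).symm
  rw [h1]
  exact g.toContinuousLinearMap.differentiableAt.comp z (differentiableAt_pi.2 fun σ => h _)

/-- The linear functionals obtained from a nonzero form of top degree by fixing all but one of its
arguments to basis vectors are multiples of the coordinates. -/
theorem ContinuousAlternatingMap.toContinuousLinearMap_basis {m : ℕ} (η : B [⋀^Fin m]→L[ℝ] ℝ)
    (b : Module.Basis (Fin m) ℝ B) (k : Fin m) (X : B) :
    η.toContinuousLinearMap b k X = η b * b.repr X k := by
  have h : (η.toContinuousLinearMap b k : B →ₗ[ℝ] ℝ) = η b • b.coord k := by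
    refine b.ext fun j => ?_
    change η (Function.update b k (b j)) = η b * b.repr (b j) k
    by_cases hj : j = k
    · subst hj
      simp
    · rw [b.repr_self, Finsupp.single_eq_of_ne (Ne.symm hj), mul_zero]
      refine η.map_eq_zero_of_eq _ (i := k) (j := j) ?_ (Ne.symm hj)
      simp [Function.update_of_ne hj]
  exact LinearMap.congr_fun h X

/-- An alternating form is determined by its values on injective families of basis vectors. In top
degree these are the permutations of `b`, which change `η b` only by a sign. -/
theorem ContinuousAlternatingMap.apply_basis_ne_zero {m : ℕ} {η : B [⋀^Fin m]→L[ℝ] ℝ}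
    (hη : η ≠ 0) (b : Module.Basis (Fin m) ℝ B) : η b ≠ 0 := by
  intro h
  apply hη
  apply ContinuousAlternatingMap.toAlternatingMap_injective
  refine b.ext_alternating fun σ hσ => ?_
  let e : Equiv.Perm (Fin m) := Equiv.ofBijective σ (Finite.injective_iff_bijective.1 hσ)
  have h1 := η.toAlternatingMap.map_perm b e
  have h2 : η.toAlternatingMap b = 0 := h
  rw [h2, smul_zero] at h1
  exact h1

end NormedSpaces

/-! ### Induced charts of J¹π and the tangent maps of π¹ and of jet fields. -/

section JetCoordinates

variable {B F M E : Type*}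
  [NormedAddCommGroup B] [NormedSpace ℝ B] [FiniteDimensional ℝ B]
  [NormedAddCommGroup F] [NormedSpace ℝ F]
  [TopologicalSpace M] [ChartedSpace B M] [IsManifold 𝓘(ℝ, B) ∞ M]
  [TopologicalSpace E] [ChartedSpace (B × F) E] [IsManifold 𝓘(ℝ, B × F) ∞ E]
  {π : SmoothBundle B F M E}

namespace FirstJet

/-- The adapted chart of `E` that induces the preferred chart of `J¹π` at `j`. -/
def adaptedChart (j : FirstJet π) : AdaptedChart π := (π.exists_adaptedChart j.pt).choose

theorem pt_mem_adaptedChart_source (j : FirstJet π) : j.pt ∈ j.adaptedChart.tot.source :=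
  (π.exists_adaptedChart j.pt).choose_spec

theorem chartAt_apply (j₀ j : FirstJet π) :
    chartAt (JetModel B F) j₀ j = (j₀.adaptedChart.tot j.pt, j₀.adaptedChart.velocity j) := rfl

theorem mem_chartAt_source {j₀ j : FirstJet π} :
    j ∈ (chartAt (JetModel B F) j₀).source ↔ j.pt ∈ j₀.adaptedChart.tot.source := Iff.rfl

theorem contMDiff_pt : ContMDiff 𝓘(ℝ, JetModel B F) 𝓘(ℝ, B × F) ∞ (FirstJet.pt (π := π)) := by
  intro j
  have h1 : ContMDiffAt 𝓘(ℝ, JetModel B F) 𝓘(ℝ, JetModel B F) ∞ (chartAt (JetModel B F) j) j :=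
    contMDiffAt_of_mem_maximalAtlas (IsManifold.chart_mem_maximalAtlas j)
      (mem_chart_source _ j)
  have h2 : ContMDiff 𝓘(ℝ, JetModel B F) 𝓘(ℝ, B × F) ∞ (Prod.fst : JetModel B F → B × F) :=
    contDiff_fst.contMDiff
  have h3 : ContMDiffAt 𝓘(ℝ, B × F) 𝓘(ℝ, B × F) ∞ j.adaptedChart.tot.symm
      (j.adaptedChart.tot j.pt) :=
    contMDiffAt_symm_of_mem_maximalAtlas j.adaptedChart.tot_mem
      (j.adaptedChart.tot.map_source j.pt_mem_adaptedChart_source)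
  have h4 := ContMDiffAt.comp (x := j)
    (g := j.adaptedChart.tot.symm) (f := Prod.fst ∘ chartAt (JetModel B F) j) h3
      (h2.contMDiffAt.comp j h1)
  refine h4.congr_of_eventuallyEq ?_
  filter_upwards [(chartAt (JetModel B F) j).open_source.mem_nhds (mem_chart_source _ j)] with i hi
  exact (j.adaptedChart.tot.left_inv hi).symm

theorem mdifferentiableAt_pt (j : FirstJet π) :
    MDifferentiableAt 𝓘(ℝ, JetModel B F) 𝓘(ℝ, B × F) (FirstJet.pt (π := π)) j :=
  (contMDiff_pt j).mdifferentiableAt (by simp)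

theorem dProjBase_eq (j : FirstJet π) : j.dProjBase = π.dProj j.pt ∘L j.dPt :=
  mfderiv_comp j (π.mdifferentiableAt j.pt) j.mdifferentiableAt_pt

/-- The domain of an induced chart is a union of fibres of π¹, so it contains both of two jets over
the same point of E or neither. A jet can thus be compared with the value of Ψ below it inside a
single chart, without appeal to a separation property of J¹π. -/
theorem pt_injOn_chart {j₀ i i' : FirstJet π} (hi : i ∈ (chartAt (JetModel B F) j₀).source)
    (h : i.pt = i'.pt)
    (h' : (chartAt (JetModel B F) j₀ i) = chartAt (JetModel B F) j₀ i') : i = i' := by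
  refine (chartAt (JetModel B F) j₀).injOn hi ?_ h'
  rw [mem_chartAt_source] at hi ⊢
  rwa [← h]

end FirstJet

namespace JetField

variable (Ψ : JetField π)

theorem mdifferentiableAt (u : E) :
    MDifferentiableAt 𝓘(ℝ, B × F) 𝓘(ℝ, JetModel B F) Ψ.toFun u :=
  (Ψ.contMDiff u).mdifferentiableAt (by simp)

theorem dPt_tangentMap (u : E) (v : B × F) : (Ψ.toFun u).dPt (Ψ.tangentMap u v) = v := by
  have h1 := mfderiv_comp u (Ψ.toFun u).mdifferentiableAt_pt (Ψ.mdifferentiableAt u)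
  have h2 : FirstJet.pt ∘ Ψ.toFun = id := funext Ψ.pt_toFun
  rw [h2, mfderiv_id] at h1
  exact (DFunLike.congr_fun h1 v).symm

theorem tangentMap_dPt {u : E} {w : JetModel B F}
    (hw : w ∈ (Ψ.tangentMap u).range) : Ψ.tangentMap u ((Ψ.toFun u).dPt w) = w := by
  obtain ⟨v, rfl⟩ := hw
  exact congrArg (Ψ.tangentMap u) (Ψ.dPt_tangentMap u v)

theorem mem_range_iff {j : FirstJet π} : j ∈ Set.range Ψ.toFun ↔ Ψ.toFun j.pt = j :=
  ⟨fun ⟨u, hu⟩ => by rw [← hu, Ψ.pt_toFun], fun h => ⟨_, h⟩⟩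

end JetField

end JetCoordinates

/-! ### Vector fields, second derivatives and differential forms in charts. -/

section Frames

variable {H N : Type*} [NormedAddCommGroup H] [NormedSpace ℝ H]
  [TopologicalSpace N] [ChartedSpace H N] [IsManifold 𝓘(ℝ, H) ∞ N]

/-- The expression of a smooth vector field in a chart is smooth. -/
theorem IsSmoothVectorFieldOn.contDiffAt_chart {X : (p : N) → TangentSpace 𝓘(ℝ, H) p} {U : Set N}
    (hX : IsSmoothVectorFieldOn X U) (hU : IsOpen U) {p : N} (hp : p ∈ U) :
    ContDiffAt ℝ ∞ (fun z : H => (mfderiv 𝓘(ℝ, H) 𝓘(ℝ, H) (chartAt H p)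
      ((chartAt H p).symm z) (X ((chartAt H p).symm z)) : H)) (chartAt H p p) := by
  have h1 := (Bundle.contMDiffWithinAt_totalSpace.1 (hX p hp)).2.contMDiffAt (hU.mem_nhds hp)
  have h2 : ContMDiffAt 𝓘(ℝ, H) 𝓘(ℝ, H) ∞
      (fun q => (mfderiv 𝓘(ℝ, H) 𝓘(ℝ, H) (chartAt H p) q (X q) : H)) p := by
    refine h1.congr_of_eventuallyEq ?_
    filter_upwards [(chartAt H p).open_source.mem_nhds (mem_chart_source H p)] with q hq
    -- The fibre coordinate of the trivialization of the tangent bundle at `p` is the tangent map of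
    -- the chart at `p`.
    have h3 := TangentBundle.continuousLinearMapAt_trivializationAt (I := 𝓘(ℝ, H)) hq
    have h4 := DFunLike.congr_fun h3 (X q)
    rw [Bundle.Trivialization.continuousLinearMapAt_apply,
      Bundle.Trivialization.coe_linearMapAt_of_mem _ (by simpa using hq)] at h4
    exact h4.symm
  have h3 : ContMDiffAt 𝓘(ℝ, H) 𝓘(ℝ, H) ∞ (chartAt H p).symm (chartAt H p p) :=
    contMDiffAt_symm_of_mem_maximalAtlas (IsManifold.chart_mem_maximalAtlas p)
      (mem_chart_target H p)
  exact (h2.comp_of_eq h3 ((chartAt H p).left_inv (mem_chart_source H p))).contDiffAt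

end Frames

theorem fderiv_fderiv_comp_add_clm {V H : Type*} [NormedAddCommGroup V] [NormedSpace ℝ V]
    [NormedAddCommGroup H] [NormedSpace ℝ H] {g : H → ℝ} {z : H}
    (hg : DifferentiableAt ℝ (fderiv ℝ g) z) (T : V →L[ℝ] H) (φ χ : V) :
    fderiv ℝ (fun φ => (fderiv ℝ g (z + T φ)) ∘L T) 0 φ χ =
      fderiv ℝ (fderiv ℝ g) z (T φ) (T χ) := by
  have h2 : HasFDerivAt (fun φ => z + T φ) T 0 := T.hasFDerivAt.const_add _
  have h3 : HasFDerivAt (fderiv ℝ g) (fderiv ℝ (fderiv ℝ g) z) (z + T 0) := by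
    rw [map_zero, add_zero]
    exact hg.hasFDerivAt
  have h4 : HasFDerivAt (fun φ => (fderiv ℝ g (z + T φ)) ∘L T) _ 0 :=
    (h3.comp 0 h2).clm_comp (hasFDerivAt_const T 0)
  rw [h4.fderiv]
  simp

section FormsInCharts

variable {H N : Type*} [NormedAddCommGroup H] [NormedSpace ℝ H]
  [TopologicalSpace N] [ChartedSpace H N] [IsManifold 𝓘(ℝ, H) ∞ N]

theorem DiffForm.apply_congr {k : ℕ} (α : DiffForm H N k) {p q : N} (h : p = q) (v : Fin k → H) :
    (α p : H [⋀^Fin k]→L[ℝ] ℝ) v = (α q : H [⋀^Fin k]→L[ℝ] ℝ) v := by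
  rw [h]

theorem DiffForm.IsSmooth.differentiableAt_inChart {k : ℕ} {α : DiffForm H N k} (hα : α.IsSmooth)
    {e : OpenPartialHomeomorph N H} (he : e ∈ IsManifold.maximalAtlas 𝓘(ℝ, H) ∞ N) {y : H}
    (hy : y ∈ e.target) : DifferentiableAt ℝ (α.inChart e) y := by
  -- Smoothness of a form refers only to charts of the atlas, while `e` may be any chart of the
  -- maximal atlas, such as the base of an adapted chart. The expression in `e` is the pullback of
  -- the expression in `e'` by the smooth transition map.
  set e' := chartAt H (e.symm y)
  have he' : e' ∈ IsManifold.maximalAtlas 𝓘(ℝ, H) ∞ N := IsManifold.chart_mem_maximalAtlas _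
  have hopen := (e.symm.trans e').open_source
  have hy' : y ∈ (e.symm.trans e').source := by
    rw [OpenPartialHomeomorph.trans_source]
    exact ⟨hy, mem_chart_source H (e.symm y)⟩
  have hτ : ContDiffOn ℝ ∞ (e' ∘ e.symm) (e.symm.trans e').source :=
    ((contMDiffOn_of_mem_maximalAtlas he').comp
      ((contMDiffOn_symm_of_mem_maximalAtlas he).mono fun x hx => hx.1) fun x hx => hx.2).contDiffOn
  have hτy := hτ.contDiffAt (hopen.mem_nhds hy')
  have h1 : DifferentiableAt ℝ (α.inChart e') ((e' ∘ e.symm) y) :=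
    ((hα e' (chart_mem_atlas H _)).contDiffAt
      (e'.open_target.mem_nhds (e'.map_source (mem_chart_source H _)))).differentiableAt (by simp)
  have h2 : DifferentiableAt ℝ (fderiv ℝ (e' ∘ e.symm)) y :=
    (hτy.fderiv_right (m := 1) (by norm_cast)).differentiableAt (by simp)
  refine ((h1.comp y (hτy.differentiableAt
    (by simp))).continuousAlternatingMapCompContinuousLinearMap h2).congr_of_eventuallyEq ?_
  filter_upwards [hopen.mem_nhds hy'] with x hx
  have hx1 : x ∈ e.target := hx.1
  have hx2 : e.symm x ∈ e'.source := hx.2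
  have hd1 : MDifferentiableAt 𝓘(ℝ, H) 𝓘(ℝ, H) (e' ∘ e.symm) x :=
    ((hτ.contDiffAt (hopen.mem_nhds hx)).differentiableAt (by simp)).mdifferentiableAt
  have hd2 : MDifferentiableAt 𝓘(ℝ, H) 𝓘(ℝ, H) e'.symm ((e' ∘ e.symm) x) :=
    (contMDiffAt_symm_of_mem_maximalAtlas he' (e'.map_source hx2)).mdifferentiableAt (by simp)
  have h3 := mfderiv_comp x hd2 hd1
  have h4 : e'.symm ∘ e' ∘ e.symm =ᶠ[𝓝 x] e.symm := by
    filter_upwards [hopen.mem_nhds hx] with x' hx' using e'.left_inv hx'.2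
  rw [h4.mfderiv_eq, mfderiv_eq_fderiv] at h3
  ext v
  have h5 : e.symm x = e'.symm ((e' ∘ e.symm) x) := (e'.left_inv hx2).symm
  refine (α.apply_congr h5 _).trans ?_
  change (α _ : H [⋀^Fin k]→L[ℝ] ℝ) _ = (α _ : H [⋀^Fin k]→L[ℝ] ℝ) _
  congr 1
  funext i
  exact DFunLike.congr_fun h3 (v i)

end FormsInCharts

/-! ### Affine fibres of J¹π, contact forms and fibre derivatives of L in induced coordinates. -/

section CartanForm

variable {B F M E : Type*}
  [NormedAddCommGroup B] [NormedSpace ℝ B] [FiniteDimensional ℝ B]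
  [NormedAddCommGroup F] [NormedSpace ℝ F]
  [TopologicalSpace M] [ChartedSpace B M] [IsManifold 𝓘(ℝ, B) ∞ M]
  [TopologicalSpace E] [ChartedSpace (B × F) E] [IsManifold 𝓘(ℝ, B × F) ∞ E]
  {π : SmoothBundle B F M E}

namespace AdaptedChart

theorem dBase_injective (A : AdaptedChart π) {x : M} (hx : x ∈ A.base.source) :
    Function.Injective (A.dBase x) :=
  Function.LeftInverse.injective (g := A.dBaseSymm (A.base x))
    fun v => DFunLike.congr_fun (A.dBaseSymm_comp_dBase_self hx) v

theorem dTot_dTotSymm (A : AdaptedChart π) {u : E} (hu : u ∈ A.tot.source) (v : B × F) :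
    A.dTot u (A.dTotSymm (A.tot u) v) = v := by
  have h := DFunLike.congr_fun (A.dTot_comp_dTotSymm_self (A.tot.map_source hu)) v
  rwa [A.tot.left_inv hu] at h

theorem dBase_dBaseSymm (A : AdaptedChart π) {x : M} (hx : x ∈ A.base.source) (v : B) :
    A.dBase x (A.dBaseSymm (A.base x) v) = v := by
  have h := DFunLike.congr_fun (A.dBase_comp_dBaseSymm_self (A.base.map_source hx)) v
  rwa [A.base.left_inv hx] at h

theorem dTot_fst (A : AdaptedChart π) {u : E} (hu : u ∈ A.tot.source) (v : B × F) :
    (A.dTot u v).1 = A.dBase (π.proj u) (π.dProj u v) :=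
  DFunLike.congr_fun (A.fst_comp_dTot hu) v

/-- The coordinate expression of the elements of the vector space `Hom(T_{π u}M, V_uπ)` on which
`J¹_uπ` is modelled. -/
def vertCoord (A : AdaptedChart π) (u : E) : (B →L[ℝ] π.vertical u) →L[ℝ] B →L[ℝ] F :=
  ContinuousLinearMap.compL ℝ B (π.vertical u) F
      (ContinuousLinearMap.snd ℝ B F ∘L A.dTot u ∘L (π.vertical u).subtypeL) ∘L
    (ContinuousLinearMap.compL ℝ B B (π.vertical u)).flip (A.dBaseSymm (A.base (π.proj u)))

theorem vertCoord_apply (A : AdaptedChart π) (u : E) (φ : B →L[ℝ] π.vertical u) (v : B) :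
    A.vertCoord u φ v =
      (A.dTot u (φ (A.dBaseSymm (A.base (π.proj u)) v) : B × F)).2 := rfl

/-- An adapted chart of E covers the chart of M, so a vector with zero base coordinate is vertical;
any linear map B → F therefore lifts to V_uπ. Through this, regularity of L reaches every coordinate
direction `q`. -/
theorem vertCoord_surjective (A : AdaptedChart π) {u : E} (hu : u ∈ A.tot.source) :
    Function.Surjective (A.vertCoord u) := by
  intro q
  have hx := A.proj_mem u hu
  let ψ : B →L[ℝ] B × F := A.dTotSymm (A.tot u) ∘L ContinuousLinearMap.inr ℝ B F ∘L q ∘L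
    A.dBase (π.proj u)
  have hψ : ∀ v, A.dTot u (ψ v) = (0, q (A.dBase (π.proj u) v)) := fun v =>
    A.dTot_dTotSymm hu _
  have hv : ∀ v, ψ v ∈ π.vertical u := fun v => by
    apply A.dBase_injective hx
    have h := A.dTot_fst hu (ψ v)
    rw [hψ] at h
    rw [map_zero]
    exact h.symm
  refine ⟨ψ.codRestrict (π.vertical u) hv, ?_⟩
  ext v
  rw [vertCoord_apply]
  change (A.dTot u (ψ _)).2 = _
  rw [hψ, A.dBase_dBaseSymm hx]

theorem velocity_translate (A : AdaptedChart π) (j : FirstJet π) (φ : B →L[ℝ] π.vertical j.pt) :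
    A.velocity (j.translate φ) = A.velocity j + A.vertCoord j.pt φ := by
  ext v
  have h : A.velocity (j.translate φ) v = (A.dTot j.pt
    (j.horMap (A.dBaseSymm (A.base (π.proj j.pt)) v) +
      (φ (A.dBaseSymm (A.base (π.proj j.pt)) v) : B × F))).2 := rfl
  rw [h, map_add]
  rfl

theorem velocity_apply (A : AdaptedChart π) (j : FirstJet π) (v : B) :
    A.velocity j v = (A.dTot j.pt (j.horMap (A.dBaseSymm (A.base (π.proj j.pt)) v))).2 := rfl

end AdaptedChart

namespace FirstJet

theorem chartAt_translate (j₀ j : FirstJet π) (φ : B →L[ℝ] π.vertical j.pt) :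
    chartAt (JetModel B F) j₀ (j.translate φ) =
      chartAt (JetModel B F) j₀ j + (0, j₀.adaptedChart.vertCoord j.pt φ) := by
  rw [chartAt_apply, chartAt_apply, AdaptedChart.velocity_translate]
  exact Prod.ext (add_zero _).symm rfl

/-- The tangent map at `j` of the preferred chart of `J¹π` at `j₀`. -/
def dChart (j₀ j : FirstJet π) : JetModel B F →L[ℝ] JetModel B F :=
  mfderiv 𝓘(ℝ, JetModel B F) 𝓘(ℝ, JetModel B F) (chartAt (JetModel B F) j₀) j

/-- The tangent map at `z` of the inverse of the preferred chart of `J¹π` at `j₀`. -/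
def dChartSymm (j₀ : FirstJet π) (z : JetModel B F) : JetModel B F →L[ℝ] JetModel B F :=
  mfderiv 𝓘(ℝ, JetModel B F) 𝓘(ℝ, JetModel B F) (chartAt (JetModel B F) j₀).symm z

theorem mdifferentiableAt_chartAt {j₀ j : FirstJet π}
    (hj : j ∈ (chartAt (JetModel B F) j₀).source) :
    MDifferentiableAt 𝓘(ℝ, JetModel B F) 𝓘(ℝ, JetModel B F) (chartAt (JetModel B F) j₀) j :=
  (contMDiffAt_of_mem_maximalAtlas (n := ∞) (IsManifold.chart_mem_maximalAtlas j₀)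
    hj).mdifferentiableAt (by simp)

theorem mdifferentiableAt_chartAt_symm {j₀ : FirstJet π} {z : JetModel B F}
    (hz : z ∈ (chartAt (JetModel B F) j₀).target) :
    MDifferentiableAt 𝓘(ℝ, JetModel B F) 𝓘(ℝ, JetModel B F) (chartAt (JetModel B F) j₀).symm z :=
  (contMDiffAt_symm_of_mem_maximalAtlas (n := ∞) (IsManifold.chart_mem_maximalAtlas j₀)
    hz).mdifferentiableAt (by simp)

theorem dChart_dChartSymm {j₀ : FirstJet π} {z : JetModel B F}
    (hz : z ∈ (chartAt (JetModel B F) j₀).target) (v : JetModel B F) :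
    dChart j₀ ((chartAt (JetModel B F) j₀).symm z) (dChartSymm j₀ z v) = v := by
  have h1 := mfderiv_comp z
    (mdifferentiableAt_chartAt ((chartAt (JetModel B F) j₀).map_target hz))
    (mdifferentiableAt_chartAt_symm hz)
  have h2 : chartAt (JetModel B F) j₀ ∘ (chartAt (JetModel B F) j₀).symm =ᶠ[𝓝 z] id := by
    filter_upwards [(chartAt (JetModel B F) j₀).open_target.mem_nhds hz] with y hy
      using (chartAt (JetModel B F) j₀).right_inv hy
  rw [h2.mfderiv_eq, mfderiv_id] at h1
  exact (DFunLike.congr_fun h1 v).symm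

theorem dChartSymm_dChart {j₀ j : FirstJet π}
    (hj : j ∈ (chartAt (JetModel B F) j₀).source) (v : JetModel B F) :
    dChartSymm j₀ (chartAt (JetModel B F) j₀ j) (dChart j₀ j v) = v := by
  have h1 := mfderiv_comp j
    (mdifferentiableAt_chartAt_symm ((chartAt (JetModel B F) j₀).map_source hj))
    (mdifferentiableAt_chartAt hj)
  have h2 : (chartAt (JetModel B F) j₀).symm ∘ chartAt (JetModel B F) j₀ =ᶠ[𝓝 j] id := by
    filter_upwards [(chartAt (JetModel B F) j₀).open_source.mem_nhds hj] with y hy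
      using (chartAt (JetModel B F) j₀).left_inv hy
  rw [h2.mfderiv_eq, mfderiv_id] at h1
  exact (DFunLike.congr_fun h1 v).symm

theorem dChart_fst {j₀ j : FirstJet π} (hj : j ∈ (chartAt (JetModel B F) j₀).source)
    (w : JetModel B F) : (dChart j₀ j w).1 = j₀.adaptedChart.dTot j.pt (j.dPt w) := by
  have h1 := mfderiv_comp j (j₀.adaptedChart.mdiff_tot hj) j.mdifferentiableAt_pt
  have hfst : MDifferentiableAt 𝓘(ℝ, JetModel B F) 𝓘(ℝ, B × F) (Prod.fst : JetModel B F → B × F)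
      (chartAt (JetModel B F) j₀ j) := differentiableAt_fst.mdifferentiableAt
  have h2 := mfderiv_comp j hfst (mdifferentiableAt_chartAt hj)
  have h3 : j₀.adaptedChart.tot ∘ FirstJet.pt = Prod.fst ∘ chartAt (JetModel B F) j₀ := rfl
  rw [h3, h2, mfderiv_eq_fderiv, fderiv_fst] at h1
  exact DFunLike.congr_fun h1 w

theorem dChart_fst_fst {j₀ j : FirstJet π} (hj : j ∈ (chartAt (JetModel B F) j₀).source)
    (w : JetModel B F) :
    (dChart j₀ j w).1.1 = j₀.adaptedChart.dBase j.projBase (j.dProjBase w) := by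
  rw [dChart_fst hj, j₀.adaptedChart.dTot_fst hj, dProjBase_eq]
  rfl

theorem dProjBase_eq_dBaseSymm {j₀ j : FirstJet π} (hj : j ∈ (chartAt (JetModel B F) j₀).source)
    (w : JetModel B F) : j.dProjBase w =
      j₀.adaptedChart.dBaseSymm (j₀.adaptedChart.base j.projBase) (dChart j₀ j w).1.1 := by
  have hx : j.projBase ∈ j₀.adaptedChart.base.source := j₀.adaptedChart.proj_mem _ hj
  rw [dChart_fst_fst hj]
  exact (DFunLike.congr_fun (j₀.adaptedChart.dBaseSymm_comp_dBase_self hx) _).symm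

/-- In coordinates the structure form has the contact forms du^α - uᵢ^α dxⁱ as its components. -/
theorem dTot_structureForm {j₀ j : FirstJet π} (hj : j ∈ (chartAt (JetModel B F) j₀).source)
    (w : JetModel B F) : (j₀.adaptedChart.dTot j.pt (j.structureForm w : B × F)).2 =
      (dChart j₀ j w).1.2 - j₀.adaptedChart.velocity j (dChart j₀ j w).1.1 := by
  have h1 : (j.structureForm w : B × F) = j.dPt w - j.horMap (j.dProjBase w) := by
    rw [dProjBase_eq]; rfl
  rw [h1, map_sub, AdaptedChart.velocity_apply, dChart_fst hj, Prod.snd_sub]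
  have h2 := dProjBase_eq_dBaseSymm hj w
  rw [dChart_fst hj] at h2
  rw [h2]
  rfl

end FirstJet

/-- The Lagrangian function in the preferred chart of `J¹π` at `j₀`. -/
def lagrangianInChart (L : FirstJet π → ℝ) (j₀ : FirstJet π) : JetModel B F → ℝ :=
  L ∘ (chartAt (JetModel B F) j₀).symm

theorem contDiffAt_lagrangianInChart {L : FirstJet π → ℝ}
    (hL : ContMDiff 𝓘(ℝ, JetModel B F) 𝓘(ℝ, ℝ) ∞ L) {j₀ : FirstJet π} {z : JetModel B F}
    (hz : z ∈ (chartAt (JetModel B F) j₀).target) :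
    ContDiffAt ℝ ∞ (lagrangianInChart L j₀) z :=
  (hL.contMDiffAt.comp z (contMDiffAt_symm_of_mem_maximalAtlas (n := ∞)
    (IsManifold.chart_mem_maximalAtlas j₀) hz)).contDiffAt

/-- Translation in the affine fibre is addition of a vector (0, p) in the induced chart, so the
intrinsic fibre derivative is the partial derivative in the velocities. -/
theorem fderiv_comp_translate {L : FirstJet π → ℝ}
    (hL : ContMDiff 𝓘(ℝ, JetModel B F) 𝓘(ℝ, ℝ) ∞ L) {j₀ j : FirstJet π}
    (hj : j ∈ (chartAt (JetModel B F) j₀).source) (φ χ : B →L[ℝ] π.vertical j.pt) :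
    fderiv ℝ (fun φ => L (j.translate φ)) φ χ =
      fderiv ℝ (lagrangianInChart L j₀) (chartAt (JetModel B F) j₀ (j.translate φ))
        (0, j₀.adaptedChart.vertCoord j.pt χ) := by
  have hs : ∀ φ, j.translate φ ∈ (chartAt (JetModel B F) j₀).source := fun φ => hj
  have h1 : (fun φ => L (j.translate φ)) = lagrangianInChart L j₀ ∘ fun φ =>
      chartAt (JetModel B F) j₀ j + (0, j₀.adaptedChart.vertCoord j.pt φ) := by
    funext φ
    rw [Function.comp_apply, ← FirstJet.chartAt_translate]
    exact congrArg L ((chartAt (JetModel B F) j₀).left_inv (hs φ)).symm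
  have h2 : HasFDerivAt (fun φ => chartAt (JetModel B F) j₀ j +
      ((0 : B × F), j₀.adaptedChart.vertCoord j.pt φ))
      (ContinuousLinearMap.inr ℝ (B × F) (B →L[ℝ] F) ∘L j₀.adaptedChart.vertCoord j.pt) φ :=
    ((ContinuousLinearMap.inr ℝ (B × F) (B →L[ℝ] F) ∘L
      j₀.adaptedChart.vertCoord j.pt).hasFDerivAt).const_add _
  have h3 := (contDiffAt_lagrangianInChart hL
    ((chartAt (JetModel B F) j₀).map_source (hs φ))).differentiableAt (by simp)
  rw [FirstJet.chartAt_translate] at h3 ⊢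
  rw [h1, (h3.hasFDerivAt.comp φ h2).fderiv]
  rfl

theorem FirstJet.translate_zero (j : FirstJet π) : j.translate 0 = j :=
  FirstJet.ext_of_eq rfl (by
    change j.horMap + _ = j.horMap
    rw [ContinuousLinearMap.comp_zero, add_zero])

theorem verticalDeriv_apply {L : FirstJet π → ℝ}
    (hL : ContMDiff 𝓘(ℝ, JetModel B F) 𝓘(ℝ, ℝ) ∞ L) {j₀ j : FirstJet π}
    (hj : j ∈ (chartAt (JetModel B F) j₀).source) (χ : B →L[ℝ] π.vertical j.pt) :
    verticalDeriv L j χ =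
      fderiv ℝ (lagrangianInChart L j₀) (chartAt (JetModel B F) j₀ j)
        (0, j₀.adaptedChart.vertCoord j.pt χ) := by
  have h := fderiv_comp_translate hL hj 0 χ
  rwa [FirstJet.translate_zero] at h

theorem verticalHessian_apply {L : FirstJet π → ℝ}
    (hL : ContMDiff 𝓘(ℝ, JetModel B F) 𝓘(ℝ, ℝ) ∞ L) {j₀ j : FirstJet π}
    (hj : j ∈ (chartAt (JetModel B F) j₀).source) (φ χ : B →L[ℝ] π.vertical j.pt) :
    verticalHessian L j φ χ =
      fderiv ℝ (fderiv ℝ (lagrangianInChart L j₀)) (chartAt (JetModel B F) j₀ j)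
        (0, j₀.adaptedChart.vertCoord j.pt φ) (0, j₀.adaptedChart.vertCoord j.pt χ) := by
  set T := ContinuousLinearMap.inr ℝ (B × F) (B →L[ℝ] F) ∘L j₀.adaptedChart.vertCoord j.pt
  have h1 : fderiv ℝ (fun φ => L (j.translate φ)) = fun φ =>
      (fderiv ℝ (lagrangianInChart L j₀) (chartAt (JetModel B F) j₀ j + T φ)) ∘L T := by
    funext φ
    ext χ
    rw [fderiv_comp_translate hL hj, FirstJet.chartAt_translate]
    rfl
  unfold verticalHessian
  rw [h1]
  exact fderiv_fderiv_comp_add_clm ((contDiffAt_lagrangianInChart hL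
      ((chartAt (JetModel B F) j₀).map_source hj)).fderiv_right (m := 1)
        (by norm_cast) |>.differentiableAt (by simp)) T φ χ

end CartanForm

/-! ### The Cartan form and its exterior derivative in coordinates. -/

section CartanCoordinates

variable {B F : Type*}
  [NormedAddCommGroup B] [NormedSpace ℝ B] [FiniteDimensional ℝ B]
  [NormedAddCommGroup F] [NormedSpace ℝ F]

theorem DifferentiableAt.alternatingMap_toContinuousLinearMap {Z : Type*} [NormedAddCommGroup Z]
    [NormedSpace ℝ Z] {m : ℕ} {β : Z → B [⋀^Fin m]→L[ℝ] ℝ} {z : Z} (hβ : DifferentiableAt ℝ β z)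
    (b : Fin m → B) (k : Fin m) :
    DifferentiableAt ℝ (fun z => (β z).toContinuousLinearMap b k) z := by
  let e := Module.finBasis ℝ B
  -- Expanding the free argument in a basis reduces the claim to finitely many scalar functions.
  have h : (fun z => (β z).toContinuousLinearMap b k) = fun z =>
      ∑ l, β z (Function.update b k (e l)) • (e.coord l).toContinuousLinearMap := by
    funext z
    apply ContinuousLinearMap.coe_injective
    refine e.ext fun i => ?_
    rw [ContinuousLinearMap.coe_coe, ContinuousLinearMap.coe_coe, _root_.sum_apply,
      Finset.sum_eq_single i]
    · simp [ContinuousAlternatingMap.toContinuousLinearMap]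
    · intro l _ hl
      simp [Finsupp.single_eq_of_ne hl]
    · simp
  rw [h]
  exact DifferentiableAt.fun_sum fun l _ =>
    (hβ.continuousAlternatingMap_apply fun _ => differentiableAt_const _).smul_const _

/-- The coordinate expression of the Cartan form of the Lagrangian function `g`, with respect to
the volume form `β`. -/
def cartanCoord {m : ℕ} (β : B → B [⋀^Fin m]→L[ℝ] ℝ) (g : JetModel B F → ℝ) (z : JetModel B F)
    (v : Fin m → JetModel B F) : ℝ :=
  ∑ k, fderiv ℝ g z (0, ((β z.1.1).toContinuousLinearMap (fun i => (v i).1.1) k).smulRight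
    ((v k).1.2 - z.2 (v k).1.1)) + g z * β z.1.1 fun i => (v i).1.1

theorem differentiableAt_cartanCoord {m : ℕ} {β : B → B [⋀^Fin m]→L[ℝ] ℝ}
    {g : JetModel B F → ℝ} {z : JetModel B F} (hβ : DifferentiableAt ℝ β z.1.1)
    (hg : ContDiffAt ℝ ∞ g z) (v : Fin m → JetModel B F) :
    DifferentiableAt ℝ (fun z => cartanCoord β g z v) z := by
  have h1 : DifferentiableAt ℝ (fun z : JetModel B F => z.1.1) z :=
    differentiableAt_fst.fst
  have h2 : DifferentiableAt ℝ (fun z : JetModel B F => β z.1.1) z :=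
    DifferentiableAt.comp (f := fun z : JetModel B F => z.1.1) z hβ h1
  have h3 : DifferentiableAt ℝ (fderiv ℝ g) z :=
    (hg.fderiv_right (m := 1) (by norm_cast)).differentiableAt (by simp)
  refine (DifferentiableAt.fun_sum fun k _ => h3.clm_apply
    ((differentiableAt_const _).prodMk ?_)).add ((hg.differentiableAt (by simp)).mul
      (h2.continuousAlternatingMap_apply fun _ => differentiableAt_const _))
  have h4 := h2.alternatingMap_toContinuousLinearMap (fun i => (v i).1.1) k
  have h5 : DifferentiableAt ℝ (fun z : JetModel B F => (v k).1.2 - z.2 (v k).1.1) z :=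
    (differentiableAt_const _).sub (differentiableAt_snd.clm_apply (differentiableAt_const _))
  exact (((ContinuousLinearMap.smulRightL ℝ B F).differentiableAt.comp z h4).clm_apply h5)

/-- The Cartan form is semibasic over E: only the (x, u)-components of its arguments enter. -/
theorem cartanCoord_eq_zero {m : ℕ} (β : B → B [⋀^Fin m]→L[ℝ] ℝ) (g : JetModel B F → ℝ)
    (z : JetModel B F) {v : Fin m → JetModel B F} {l : Fin m} (hl : (v l).1 = 0) :
    cartanCoord β g z v = 0 := by
  have h1 : β z.1.1 (fun i => (v i).1.1) = 0 := by
    refine (β z.1.1).map_coord_zero l ?_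
    rw [hl]; rfl
  rw [cartanCoord, h1, mul_zero, add_zero]
  refine Finset.sum_eq_zero fun k _ => ?_
  have h2 : ((β z.1.1).toContinuousLinearMap (fun i => (v i).1.1) k).smulRight
      ((v k).1.2 - z.2 (v k).1.1) = 0 := by
    by_cases hk : k = l
    · subst hk
      rw [hl]
      ext X
      simp
    · ext X
      have h3 : (β z.1.1).toContinuousLinearMap (fun i => (v i).1.1) k X = 0 := by
        refine (β z.1.1).map_coord_zero (m := Function.update (fun i => (v i).1.1) k X) l ?_
        rw [Function.update_of_ne (Ne.symm hk), hl]
        rfl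
      rw [ContinuousLinearMap.smulRight_apply, h3, zero_smul]
      rfl
  rw [h2, ← Prod.zero_eq_mk, map_zero]

/-- A vector vertical over M kills every term in which it is an argument of `β`; it escapes only in
the term where its own slot is overwritten. -/
theorem cartanCoord_eq_single {m : ℕ} (β : B → B [⋀^Fin m]→L[ℝ] ℝ) (g : JetModel B F → ℝ)
    (z : JetModel B F) {v : Fin m → JetModel B F} {k : Fin m} (hk : (v k).1.1 = 0) :
    cartanCoord β g z v = fderiv ℝ g z
      (0, ((β z.1.1).toContinuousLinearMap (fun i => (v i).1.1) k).smulRight (v k).1.2) := by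
  have h1 : β z.1.1 (fun i => (v i).1.1) = 0 := (β z.1.1).map_coord_zero k hk
  rw [cartanCoord, h1, mul_zero, add_zero, Finset.sum_eq_single k]
  · rw [hk, map_zero, sub_zero]
  · intro i _ hi
    have h2 : ((β z.1.1).toContinuousLinearMap (fun i => (v i).1.1) i).smulRight
        ((v i).1.2 - z.2 (v i).1.1) = 0 := by
      ext X
      have h3 : (β z.1.1).toContinuousLinearMap (fun i => (v i).1.1) i X = 0 := by
        refine (β z.1.1).map_coord_zero (m := Function.update (fun i => (v i).1.1) i X) k ?_
        rw [Function.update_of_ne (Ne.symm hi), hk]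
      rw [ContinuousLinearMap.smulRight_apply, h3, zero_smul]
      rfl
    rw [h2, ← Prod.zero_eq_mk, map_zero]
  · simp

/-- The contraction of the exterior derivative of the Cartan form with a vector tangent to the
fibres of `J¹π → E`, evaluated on vectors one of which projects to a vertical vector. -/
theorem extDeriv_cartanCoord {m : ℕ} {β : B → B [⋀^Fin m]→L[ℝ] ℝ} {g : JetModel B F → ℝ}
    {z : JetModel B F} (hg : ContDiffAt ℝ ∞ g z)
    {α : JetModel B F → JetModel B F [⋀^Fin m]→L[ℝ] ℝ}
    (hαβ : ∀ᶠ y in 𝓝 z, ∀ v, α y v = cartanCoord β g y v) (hα : DifferentiableAt ℝ α z)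
    (q : B →L[ℝ] F) {v : Fin m → JetModel B F} {k : Fin m} (hk : (v k).1.1 = 0) :
    extDeriv α z (Fin.cons ((0, q) : JetModel B F) v) = fderiv ℝ (fderiv ℝ g) z (0, q)
      (0, ((β z.1.1).toContinuousLinearMap (fun i => (v i).1.1) k).smulRight (v k).1.2) := by
  set χ : B →L[ℝ] F :=
    ((β z.1.1).toContinuousLinearMap (fun i => (v i).1.1) k).smulRight (v k).1.2
  set ξ : JetModel B F := (0, q)
  rw [extDeriv_apply hα, Fin.sum_univ_succ]
  have hsucc : ∀ i : Fin m, fderiv ℝ (fun y => α y (i.succ.removeNth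
      (Fin.cons ξ v : Fin (m + 1) → JetModel B F))) z = 0 := by
    intro i
    -- The existence of `i` forces m > 0, so after removal of a later slot, slot 0 is still there
    -- and holds `ξ`, which projects to zero in E.
    obtain ⟨n, rfl⟩ : ∃ n, m = n + 1 := ⟨m - 1, by have := i.2; omega⟩
    have h1 : (fun y => α y (i.succ.removeNth
        (Fin.cons ξ v : Fin (n + 1 + 1) → JetModel B F))) =ᶠ[𝓝 z] fun _ => 0 := by
      filter_upwards [hαβ] with y hy
      rw [hy]
      exact cartanCoord_eq_zero β g y (l := 0) rfl
    rw [h1.fderiv_eq, fderiv_const_apply]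
  have h0 : (Fin.removeNth 0 (Fin.cons ξ v : Fin (m + 1) → JetModel B F)) = v := by
    funext i; rfl
  simp only [hsucc, zero_apply, smul_zero, Finset.sum_const_zero, add_zero, Fin.val_zero, pow_zero,
    one_smul, h0, Fin.cons_zero]
  have hd : DifferentiableAt ℝ (fun y => α y v) z :=
    hα.continuousAlternatingMap_apply fun _ => differentiableAt_const _
  rw [← hd.lineDeriv_eq_fderiv]
  have h3 : HasFDerivAt (fderiv ℝ g) (fderiv ℝ (fderiv ℝ g) z) z :=
    ((hg.fderiv_right (m := 1) (by norm_cast)).differentiableAt (by simp)).hasFDerivAt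
  have hline : Filter.Tendsto (fun t : ℝ => z + t • ξ) (𝓝 0) (𝓝 z) := by
    have : Continuous fun t : ℝ => z + t • ξ := by fun_prop
    simpa using this.tendsto 0
  -- On the line z + tξ only the velocities vary. The base point, and with it `β` and `χ`, is
  -- constant, so a further derivative of `g` gives the Hessian.
  have h4 : HasLineDerivAt ℝ (fun y => fderiv ℝ g y (0, χ))
      (fderiv ℝ (fderiv ℝ g) z ξ (0, χ)) z ξ := by
    have h5 := (h3.clm_apply (hasFDerivAt_const ((0, χ) : JetModel B F) z)).hasLineDerivAt ξ
    simpa using h5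
  refine HasDerivAt.deriv (HasDerivAt.congr_of_eventuallyEq h4 ?_)
  filter_upwards [hline.eventually hαβ] with t ht
  rw [ht, cartanCoord_eq_single β g _ hk]
  have h6 : (z + t • ξ).1.1 = z.1.1 := by simp [ξ]
  rw [h6]

end CartanCoordinates

/-! ### Nondegeneracy of Ω_𝓛 along the fibres of π¹, and Lagrangian images. -/

section CartanForm

variable {B F M E : Type*}
  [NormedAddCommGroup B] [NormedSpace ℝ B] [FiniteDimensional ℝ B]
  [NormedAddCommGroup F] [NormedSpace ℝ F]
  [TopologicalSpace M] [ChartedSpace B M] [IsManifold 𝓘(ℝ, B) ∞ M]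
  [TopologicalSpace E] [ChartedSpace (B × F) E] [IsManifold 𝓘(ℝ, B × F) ∞ E]
  {π : SmoothBundle B F M E}

open FirstJet

/-- Each ingredient has a known expression: the vertical derivative of L is the velocity part of the
differential, the structure form gives the contact forms, and η is read in the adapted base chart.
-/
theorem cartanForm_apply {m : ℕ} (η : DiffForm B M m) {L : FirstJet π → ℝ}
    (hL : ContMDiff 𝓘(ℝ, JetModel B F) 𝓘(ℝ, ℝ) ∞ L) {j₀ j : FirstJet π}
    (hj : j ∈ (chartAt (JetModel B F) j₀).source) (w : Fin m → JetModel B F) :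
    (cartanForm η L j : JetModel B F [⋀^Fin m]→L[ℝ] ℝ) w =
      cartanCoord (η.inChart j₀.adaptedChart.base) (lagrangianInChart L j₀)
        (chartAt (JetModel B F) j₀ j) fun i => dChart j₀ j (w i) := by
  set A := j₀.adaptedChart
  set z := chartAt (JetModel B F) j₀ j
  have hx : j.projBase ∈ A.base.source := A.proj_mem _ hj
  have hz : z.1.1 = A.base j.projBase := (A.base_proj _ hj).symm
  -- The value of `η` is retyped as a form on the model space, so that its type no longer depends on
  -- the point.
  obtain ⟨ηx, hηx⟩ : ∃ ηx : B [⋀^Fin m]→L[ℝ] ℝ, ηx = η j.projBase := ⟨_, rfl⟩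
  have hη : ∀ c : Fin m → B, η.inChart A.base z.1.1 c =
      ηx fun i => A.dBaseSymm (A.base j.projBase) (c i) := by
    intro c
    rw [hz, hηx]
    exact η.apply_congr (A.base.left_inv hx) _
  have hw : ∀ i, j.dProjBase (w i) = A.dBaseSymm (A.base j.projBase) (dChart j₀ j (w i)).1.1 :=
    fun i => dProjBase_eq_dBaseSymm hj (w i)
  have h1 : (cartanForm η L j : JetModel B F [⋀^Fin m]→L[ℝ] ℝ) w =
      ∑ k, verticalDeriv L j ((ContinuousAlternatingMap.toContinuousLinearMap ηx
        (j.dProjBase ∘ w) k).smulRight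
          (j.structureForm (w k))) +
      L j * ηx (j.dProjBase ∘ w) := by
    rw [hηx]
    rfl
  rw [h1, cartanCoord]
  congr 1
  · refine Finset.sum_congr rfl fun k _ => ?_
    refine (verticalDeriv_apply hL hj _).trans ?_
    congr 2
    ext X
    rw [AdaptedChart.vertCoord_apply]
    change (A.dTot j.pt ((_ : ℝ) • (j.structureForm (w k) : B × F))).2 = _
    rw [map_smul, Prod.smul_snd, dTot_structureForm hj, ContinuousLinearMap.smulRight_apply]
    congr 1
    refine Eq.trans ?_ (hη _).symm
    change ηx _ = _
    congr 1
    funext i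
    by_cases hi : i = k
    · subst hi
      simp
      rfl
    · rw [Function.update_of_ne hi, Function.update_of_ne hi]
      exact hw i
  · congr 1
    · exact congrArg L ((chartAt (JetModel B F) j₀).left_inv hj).symm
    · rw [hη]
      congr 1
      funext i
      exact hw i

theorem inChart_cartanForm_apply {m : ℕ} (η : DiffForm B M m) {L : FirstJet π → ℝ}
    (hL : ContMDiff 𝓘(ℝ, JetModel B F) 𝓘(ℝ, ℝ) ∞ L) (j₀ : FirstJet π) {z : JetModel B F}
    (hz : z ∈ (chartAt (JetModel B F) j₀).target) (v : Fin m → JetModel B F) :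
    (cartanForm η L).inChart (chartAt (JetModel B F) j₀) z v =
      cartanCoord (η.inChart j₀.adaptedChart.base) (lagrangianInChart L j₀) z v := by
  have h := cartanForm_apply η hL ((chartAt (JetModel B F) j₀).map_target hz)
    fun i => dChartSymm j₀ z (v i)
  rw [(chartAt (JetModel B F) j₀).right_inv hz] at h
  simp only [dChart_dChartSymm hz] at h
  exact h

theorem differentiableAt_inChart_cartanForm [FiniteDimensional ℝ F] {m : ℕ} {η : DiffForm B M m}
    (hη : η.IsSmooth) {L : FirstJet π → ℝ}
    (hL : ContMDiff 𝓘(ℝ, JetModel B F) 𝓘(ℝ, ℝ) ∞ L) (j₀ : FirstJet π) {z : JetModel B F}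
    (hz : z ∈ (chartAt (JetModel B F) j₀).target) :
    DifferentiableAt ℝ ((cartanForm η L).inChart (chartAt (JetModel B F) j₀)) z := by
  have hz' : z.1.1 ∈ j₀.adaptedChart.base.target := by
    have h1 := j₀.adaptedChart.tot.map_target hz
    have h2 := j₀.adaptedChart.base_proj _ h1
    rw [j₀.adaptedChart.tot.right_inv hz] at h2
    rw [← h2]
    exact j₀.adaptedChart.base.map_source (j₀.adaptedChart.proj_mem _ h1)
  refine ContinuousAlternatingMap.differentiableAt_of_apply fun v => ?_
  refine (differentiableAt_cartanCoord (hη.differentiableAt_inChart j₀.adaptedChart.base_mem hz')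
    (contDiffAt_lagrangianInChart hL hz) v).congr_of_eventuallyEq ?_
  filter_upwards [(chartAt (JetModel B F) j₀).open_target.mem_nhds hz] with y hy
  exact inChart_cartanForm_apply η hL j₀ hy v

theorem multisymplecticCartanForm_apply {m : ℕ} (η : DiffForm B M m) (L : FirstJet π → ℝ)
    (j : FirstJet π) (w : Fin (m + 1) → JetModel B F) :
    (multisymplecticCartanForm η L j : JetModel B F [⋀^Fin (m + 1)]→L[ℝ] ℝ) w =
      -extDeriv ((cartanForm η L).inChart (chartAt (JetModel B F) j)) (chartAt (JetModel B F) j j)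
        fun i => dChart j j (w i) := rfl

/-- The multisymplectic form of a regular Lagrangian is nondegenerate in the directions tangent to
the fibres of `J¹π → E`, even when contracted only with vectors in a subspace `W` that projects
onto the tangent space of `E`. -/
theorem eq_zero_of_multisymplecticCartanForm_eq_zero [FiniteDimensional ℝ F] {m : ℕ}
    {η : DiffForm B M m} (hη : η.IsVolumeForm) {L : FirstJet π → ℝ}
    (hL : ContMDiff 𝓘(ℝ, JetModel B F) 𝓘(ℝ, ℝ) ∞ L) (hreg : IsRegularLagrangian L)
    {j : FirstJet π} {ξ : JetModel B F} (hξ : j.dPt ξ = 0) {W : Submodule ℝ (JetModel B F)}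
    (hW : ∀ a, ∃ w ∈ W, j.dPt w = a)
    (h : ∀ v : Fin m → JetModel B F, (∀ i, v i ∈ W) →
      (multisymplecticCartanForm η L j : JetModel B F [⋀^Fin (m + 1)]→L[ℝ] ℝ)
        (Fin.cons ξ v) = 0) : ξ = 0 := by
  set A := j.adaptedChart
  set z := chartAt (JetModel B F) j j
  have hj := mem_chart_source (JetModel B F) j
  have hz : z ∈ (chartAt (JetModel B F) j).target := mem_chart_target _ j
  have hx : j.projBase ∈ A.base.source := A.proj_mem _ hj
  have hξ1 : (dChart j j ξ).1 = 0 := by rw [dChart_fst hj, hξ, map_zero]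
  set q := (dChart j j ξ).2
  have hξq : dChart j j ξ = (0, q) := Prod.ext hξ1 rfl
  have hW' : ∀ a : B × F, ∃ w ∈ W, (dChart j j w).1 = a := by
    intro a
    obtain ⟨w, hw, hwa⟩ := hW (A.dTotSymm (A.tot j.pt) a)
    exact ⟨w, hw, by rw [dChart_fst hj, hwa]; exact A.dTot_dTotSymm hj a⟩
  let b : Module.Basis (Fin m) ℝ B := (Module.finBasis ℝ B).reindex (finCongr hη.1.symm)
  set β := η.inChart A.base z.1.1
  have hβ : β ≠ 0 := by
    intro h0
    apply hη.2.2 j.projBase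
    have hzb : z.1.1 = A.base j.projBase := (A.base_proj _ hj).symm
    ext c
    have h1 : β (fun i => A.dBase j.projBase (c i)) = 0 := by rw [h0]; rfl
    have h2 : β (fun i => A.dBase j.projBase (c i)) = (η j.projBase : B [⋀^Fin m]→L[ℝ] ℝ) c := by
      change η.inChart A.base z.1.1 _ = _
      rw [hzb]
      refine (η.apply_congr (A.base.left_inv hx) _).trans ?_
      congr 1
      funext i
      exact DFunLike.congr_fun (A.dBaseSymm_comp_dBase_self hx) (c i)
    exact h2.symm.trans h1
  have hβb : β b ≠ 0 := ContinuousAlternatingMap.apply_basis_ne_zero hβ b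
  -- Test vectors: lifts to `W` of (bᵢ, 0) for i ≠ k and of the vertical (0, y) in slot k. They
  -- produce the rank-one map bᵏ ⊗ y with the nonzero factor `β b`.
  have hsingle : ∀ (k : Fin m) (y : F), fderiv ℝ (fderiv ℝ (lagrangianInChart L j)) z (0, q)
      (0, (b.coord k).toContinuousLinearMap.smulRight y) = 0 := by
    intro k y
    choose w hw hwa using hW'
    let a : Fin m → B × F := fun i => if i = k then (0, y) else (b i, 0)
    have hak : a k = (0, y) := if_pos rfl
    have h1 := h (fun i => w (a i)) fun i => hw _
    replace h1 := neg_eq_zero.1 ((multisymplecticCartanForm_apply η L j _).symm.trans h1)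
    have h2 : (fun i => dChart j j ((Fin.cons ξ fun i => w (a i) : Fin (m + 1) → JetModel B F) i)) =
        Fin.cons (0, q) fun i => dChart j j (w (a i)) := by
      funext i
      refine Fin.cases ?_ (fun i => ?_) i
      · exact hξq
      · rfl
    replace h1 : extDeriv ((cartanForm η L).inChart (chartAt (JetModel B F) j)) z
        (Fin.cons (0, q) fun i => dChart j j (w (a i))) = 0 := h2 ▸ h1
    rw [extDeriv_cartanCoord (contDiffAt_lagrangianInChart hL hz)
      (by
        filter_upwards [(chartAt (JetModel B F) j).open_target.mem_nhds hz] with x hx v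
        exact inChart_cartanForm_apply η hL j hx v)
      (differentiableAt_inChart_cartanForm hη.2.1 hL j hz) q (k := k)
      (by rw [hwa, hak])] at h1
    have h3 : (ContinuousAlternatingMap.toContinuousLinearMap β
        (fun i => (dChart j j (w (a i))).1.1) k).smulRight (dChart j j (w (a k))).1.2 =
        β b • (b.coord k).toContinuousLinearMap.smulRight y := by
      ext X
      have h4 : ContinuousAlternatingMap.toContinuousLinearMap β
          (fun i => (dChart j j (w (a i))).1.1) k X =
          ContinuousAlternatingMap.toContinuousLinearMap β b k X := by
        change β _ = β _
        congr 1
        funext i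
        by_cases hi : i = k
        · subst hi
          simp
        · rw [Function.update_of_ne hi, Function.update_of_ne hi, hwa]
          simp [a, hi]
      rw [ContinuousLinearMap.smulRight_apply, h4, β.toContinuousLinearMap_basis b k X, hwa, hak]
      simp [mul_smul]
    have h5 : ((0 : B × F), β b • (b.coord k).toContinuousLinearMap.smulRight y) =
        β b • ((0 : B × F), (b.coord k).toContinuousLinearMap.smulRight y) := by
      rw [Prod.smul_mk, smul_zero]
    rw [h3, h5, map_smul, smul_eq_mul] at h1
    exact (mul_eq_zero.1 h1).resolve_left hβb
  -- Every linear map is the sum of the rank-one maps bᵏ ⊗ χ(bₖ).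
  have hall : ∀ χ : B →L[ℝ] F,
      fderiv ℝ (fderiv ℝ (lagrangianInChart L j)) z (0, q) (0, χ) = 0 := by
    intro χ
    have h1 : ((0 : B × F), χ) = ∑ k, ((0 : B × F),
        (b.coord k).toContinuousLinearMap.smulRight (χ (b k))) := by
      refine Prod.ext (by simp [Prod.fst_sum]) ?_
      rw [Prod.snd_sum]
      apply ContinuousLinearMap.coe_injective
      refine b.ext fun i => ?_
      simp only [ContinuousLinearMap.coe_coe, _root_.sum_apply,
        ContinuousLinearMap.smulRight_apply]
      rw [Finset.sum_eq_single i]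
      · simp
      · intro l _ hl
        simp [Finsupp.single_eq_of_ne hl]
      · simp
    rw [h1, map_sum]
    exact Finset.sum_eq_zero fun k _ => hsingle k _
  obtain ⟨φ, hφ⟩ := A.vertCoord_surjective hj q
  have hφ0 : φ = 0 := hreg j φ fun χ => by
    rw [verticalHessian_apply hL hj, hφ]
    exact hall _
  have hq : q = 0 := by rw [← hφ, hφ0, map_zero]
  have h6 := dChartSymm_dChart hj ξ
  rw [hξq, hq, ← Prod.zero_eq_mk, map_zero] at h6
  exact h6.symm

/-- Ψ^*Ω = 0 gives one inclusion. For the other, a vector orthogonal to the tangent space of Im Ψ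
differs from its projection TΨ(Tπ¹ w) by a vector of ker Tπ¹ that is still orthogonal, and
nondegeneracy makes that difference zero. -/
theorem JetField.isLagrangianImage_multisymplecticCartanForm [FiniteDimensional ℝ F] {m : ℕ}
    {η : DiffForm B M m} (hη : η.IsVolumeForm) {L : FirstJet π → ℝ}
    (hL : ContMDiff 𝓘(ℝ, JetModel B F) 𝓘(ℝ, ℝ) ∞ L) (hreg : IsRegularLagrangian L)
    (Ψ : JetField π) (hΨ : Ψ.pullback (multisymplecticCartanForm η L) = 0) :
    Ψ.IsLagrangianImage (multisymplecticCartanForm η L) := by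
  intro u
  have hzero : ∀ a : Fin (m + 1) → B × F,
      (multisymplecticCartanForm η L (Ψ.toFun u) : JetModel B F [⋀^Fin (m + 1)]→L[ℝ] ℝ)
        (fun i => Ψ.tangentMap u (a i)) = 0 := fun a =>
    DFunLike.congr_fun (congrFun hΨ u) a
  have hzero' : ∀ (w : JetModel B F) (v : Fin m → JetModel B F),
      w ∈ (Ψ.tangentMap u).range → (∀ i, v i ∈ (Ψ.tangentMap u).range) →
      (multisymplecticCartanForm η L (Ψ.toFun u) : JetModel B F [⋀^Fin (m + 1)]→L[ℝ] ℝ)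
        (Fin.cons w v) = 0 := by
    rintro w v ⟨a, rfl⟩ hv
    choose c hc using hv
    rw [← hzero (Fin.cons a c)]
    congr 1
    funext i
    refine Fin.cases ?_ (fun i => ?_) i
    · rfl
    · exact (hc i).symm
  refine Set.Subset.antisymm (fun w hw v hv => hzero' w v hw hv)
    fun (w : JetModel B F) hw => ?_
  set w' : JetModel B F := Ψ.tangentMap u ((Ψ.toFun u).dPt w)
  have hw' : w' ∈ (Ψ.tangentMap u).range := ⟨_, rfl⟩
  have hξ : (Ψ.toFun u).dPt (w - w') = 0 := by
    rw [map_sub, Ψ.dPt_tangentMap, sub_self]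
  have h0 : w - w' = 0 := by
    refine eq_zero_of_multisymplecticCartanForm_eq_zero hη hL hreg hξ
      (W := (Ψ.tangentMap u).range)
      (fun a => ⟨_, ⟨a, rfl⟩, Ψ.dPt_tangentMap u a⟩) fun v hv => ?_
    set Ω : JetModel B F [⋀^Fin (m + 1)]→L[ℝ] ℝ := multisymplecticCartanForm η L (Ψ.toFun u)
    have h1 : Ω (Fin.cons w v) = 0 := hw v hv
    have h2 : Ω (Fin.cons w' v) = 0 := hzero' w' v hw' hv
    have h3 : Ω (Fin.cons (w - w' + w') v) = Ω (Fin.cons (w - w') v) + Ω (Fin.cons w' v) :=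
      Ω.toMultilinearMap.cons_add v (w - w') w'
    rw [sub_add_cancel, h1, h2, add_zero] at h3
    exact h3.symm
  rw [sub_eq_zero.1 h0]
  exact hw'

end CartanForm

theorem Submodule.map_span_range {R V W ι : Type*} [Semiring R] [AddCommMonoid V] [Module R V]
    [AddCommMonoid W] [Module R W] (f : V →ₗ[R] W) (X : ι → V) :
    (Submodule.span R (Set.range X)).map f = Submodule.span R (Set.range fun i => f (X i)) := by
  rw [Submodule.map_span, ← Set.range_comp]
  rfl

/-! ### Restriction of integral sections and connected neighbourhoods. -/

section IntegralSections

variable {B H M N : Type*} [NormedAddCommGroup B] [NormedSpace ℝ B]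
  [NormedAddCommGroup H] [NormedSpace ℝ H]
  [TopologicalSpace M] [ChartedSpace B M] [TopologicalSpace N] [ChartedSpace H N]

theorem IsLocalSection.mdifferentiableAt {p : N → M} {U : Set M} {s : M → N}
    (hs : IsLocalSection B H p U s) {x : M} (hx : x ∈ U) :
    MDifferentiableAt 𝓘(ℝ, B) 𝓘(ℝ, H) s x :=
  (hs.contMDiffOn.contMDiffAt (hs.isOpen.mem_nhds hx)).mdifferentiableAt (by simp)

theorem IsIntegralSection.mono {p : N → M} {D : SubspaceField H N} {U V : Set M} {s : M → N}
    (hs : IsIntegralSection B p D U s) (hV : IsOpen V) (hVU : V ⊆ U) :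
    IsIntegralSection B p D V s :=
  ⟨⟨hV, hs.1.contMDiffOn.mono hVU, fun x hx => hs.1.proj_eq x (hVU hx)⟩,
    fun x hx => hs.2 x (hVU hx)⟩

theorem ChartedSpace.exists_isOpen_isConnected_subset [FiniteDimensional ℝ B] {U : Set M}
    (hU : IsOpen U) {x : M} (hx : x ∈ U) : ∃ V ⊆ U, IsOpen V ∧ x ∈ V ∧ IsConnected V := by
  have : LocallyConnectedSpace M := ChartedSpace.locallyConnectedSpace B M
  exact locallyConnectedSpace_iff_subsets_isOpen_isConnected.1 this x U (hU.mem_nhds hx)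

end IntegralSections

/-! ### Tangency of D to Im Ψ and the Hamilton–Jacobi conditions. -/

section HamiltonJacobi

variable {B F M E : Type*}
  [NormedAddCommGroup B] [NormedSpace ℝ B] [FiniteDimensional ℝ B]
  [NormedAddCommGroup F] [NormedSpace ℝ F]
  [TopologicalSpace M] [ChartedSpace B M] [IsManifold 𝓘(ℝ, B) ∞ M]
  [TopologicalSpace E] [ChartedSpace (B × F) E] [IsManifold 𝓘(ℝ, B × F) ∞ E]
  {π : SmoothBundle B F M E}

open FirstJet

/-- The projection of a Lagrangian distribution to `E` consists of the horizontal subspaces. -/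
theorem IsLagrangianDistribution.map_dPt {m : ℕ} {η : DiffForm B M m} {L : FirstJet π → ℝ}
    {D : SubspaceField (JetModel B F) (FirstJet π)} (hD : IsLagrangianDistribution η L D)
    (j : FirstJet π) :
    (D j).map (j.dPt : JetModel B F →ₗ[ℝ] B × F) = j.horMap.range := by
  obtain ⟨U, σ, hσ, x, hx, rfl⟩ := hD.integrable j
  obtain ⟨φ, hφ, hσφ⟩ := hD.isProlongation U σ hσ
  have h1 : FirstJet.pt ∘ σ =ᶠ[𝓝 x] φ := by
    filter_upwards [hφ.isOpen.mem_nhds hx] with y hy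
    rw [Function.comp_apply, hσφ y hy]
    rfl
  -- Since σ = j¹φ, differentiating π¹ ∘ σ = φ expresses the horizontal map Tφ of the jet σ(x) as
  -- Tπ¹ ∘ Tσ, and the image of Tσ is `D`.
  have h2 := mfderiv_comp x (σ x).mdifferentiableAt_pt (hσ.1.mdifferentiableAt hx)
  rw [h1.mfderiv_eq] at h2
  have h3 : ((σ x).horMap : B →L[ℝ] B × F) =
      (σ x).dPt ∘L (mfderiv 𝓘(ℝ, B) 𝓘(ℝ, JetModel B F) σ x : B →L[ℝ] JetModel B F) := by
    refine Eq.trans ?_ h2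
    rw [hσφ x hx]
    rfl
  rw [h3, ← hσ.2 x hx]
  exact (LinearMap.range_comp _ _).symm

theorem IsLagrangianDistribution.disjoint_ker_dPt {m : ℕ} {η : DiffForm B M m}
    {L : FirstJet π → ℝ} {D : SubspaceField (JetModel B F) (FirstJet π)}
    (hD : IsLagrangianDistribution η L D) (j : FirstJet π) : Disjoint (D j) j.dPt.ker := by
  refine (hD.transverse j).mono_right fun (v : JetModel B F) hv => ?_
  have hv' : j.dPt v = 0 := hv
  change j.dProjBase v = 0
  rw [dProjBase_eq]
  change π.dProj j.pt (j.dPt v) = 0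
  rw [hv', map_zero]

namespace JetField

variable (Ψ : JetField π) {m : ℕ} {η : DiffForm B M m} {L : FirstJet π → ℝ}
  {D : SubspaceField (JetModel B F) (FirstJet π)}

theorem associated_eq_distribution (hD : IsLagrangianDistribution η L D) :
    Ψ.associated D = Ψ.distribution := funext fun u => hD.map_dPt (Ψ.toFun u)

/-- A linear section of Tπ is determined by its image, and Tγ takes its values in the horizontal
space of Ψ(γ x). -/
theorem toFun_eq_prolongation {U : Set M} {γ : M → E}
    (hγ : IsIntegralSection B π.proj Ψ.distribution U γ) {x : M} (hx : x ∈ U) :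
    Ψ.toFun (γ x) = FirstJet.prolongation hγ.1 hx := by
  refine FirstJet.ext_of_eq (Ψ.pt_toFun _) ?_
  change (Ψ.toFun (γ x)).horMap = (FirstJet.prolongation hγ.1 hx).horMap
  ext1 v
  have h1 : (FirstJet.prolongation hγ.1 hx).horMap v ∈ (Ψ.toFun (γ x)).horMap.range := by
    have h2 : mfderiv 𝓘(ℝ, B) 𝓘(ℝ, B × F) γ x v ∈ Ψ.distribution (γ x) := by
      rw [← hγ.2 x hx]
      exact ⟨v, rfl⟩
    exact h2
  obtain ⟨b, hb⟩ := h1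
  have hb' : (Ψ.toFun (γ x)).horMap b = (FirstJet.prolongation hγ.1 hx).horMap v := hb
  have h3 := (Ψ.toFun (γ x)).dProj_horMap b
  rw [Ψ.pt_toFun, hb'] at h3
  have h4 : b = v := h3.symm.trans ((FirstJet.prolongation hγ.1 hx).dProj_horMap v)
  rw [← hb', h4]

theorem mfderiv_comp_section {γ : M → E} {x : M}
    (hγ : MDifferentiableAt 𝓘(ℝ, B) 𝓘(ℝ, B × F) γ x) :
    (mfderiv 𝓘(ℝ, B) 𝓘(ℝ, JetModel B F) (Ψ.toFun ∘ γ) x : B →L[ℝ] JetModel B F) =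
      Ψ.tangentMap (γ x) ∘L (mfderiv 𝓘(ℝ, B) 𝓘(ℝ, B × F) γ x : B →L[ℝ] B × F) :=
  mfderiv_comp x (Ψ.mdifferentiableAt (γ x)) hγ

theorem isLocalSection_comp {U : Set M} {γ : M → E}
    (hγ : IsLocalSection B (B × F) π.proj U γ) :
    IsLocalSection B (JetModel B F) FirstJet.projBase U (Ψ.toFun ∘ γ) where
  isOpen := hγ.isOpen
  contMDiffOn := Ψ.contMDiff.comp_contMDiffOn hγ.contMDiffOn
  proj_eq x hx := by
    rw [Function.comp_apply, FirstJet.projBase, Ψ.pt_toFun, hγ.proj_eq x hx]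

/-- A local frame of `D` along Im Ψ is pushed forward by Tπ¹; it stays independent because `D`,
being transverse over M, meets ker Tπ¹ trivially. -/
theorem associated_isDistribution (hD : IsLagrangianDistribution η L D) :
    (Ψ.associated D).IsDistribution m := by
  intro u
  obtain ⟨U, hU, hu, X, hX, hXD⟩ := hD.isDistribution (Ψ.toFun u)
  refine ⟨Ψ.toFun ⁻¹' U, hU.preimage Ψ.contMDiff.continuous, hu,
    fun i v => ((Ψ.toFun v).dPt (X i (Ψ.toFun v)) : B × F), fun i => ?_, fun v hv => ?_⟩
  · have h1 : ContMDiff 𝓘(ℝ, JetModel B F).tangent 𝓘(ℝ, B × F).tangent ∞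
        (_root_.tangentMap 𝓘(ℝ, JetModel B F) 𝓘(ℝ, B × F) (FirstJet.pt (π := π))) :=
      contMDiff_pt.contMDiff_tangentMap (by simp)
    have h2 := h1.comp_contMDiffOn ((hX i).comp Ψ.contMDiff.contMDiffOn (Set.Subset.refl _))
    refine h2.congr fun v hv => ?_
    have h3 : ∀ (a b : E) (_ : a = b) (w : B × F),
        (⟨b, w⟩ : TangentBundle 𝓘(ℝ, B × F) E) = ⟨a, w⟩ := by
      rintro a _ rfl w
      rfl
    exact h3 _ _ (Ψ.pt_toFun v) _
  · obtain ⟨hli, hspan⟩ := hXD _ hv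
    have hdisj : Disjoint (Submodule.span ℝ (Set.range fun i => X i (Ψ.toFun v)))
        (LinearMap.ker ((Ψ.toFun v).dPt : JetModel B F →ₗ[ℝ] B × F)) := by
      rw [hspan]
      exact hD.disjoint_ker_dPt _
    refine ⟨hli.map hdisj, ?_⟩
    change _ = (D (Ψ.toFun v)).map ((Ψ.toFun v).dPt : JetModel B F →ₗ[ℝ] B × F)
    rw [← hspan]
    exact (Submodule.map_span_range ((Ψ.toFun v).dPt : JetModel B F →ₗ[ℝ] B × F)
      fun i => X i (Ψ.toFun v)).symm

theorem isTangentToImage_of_isGeneralizedSolution (h : Ψ.IsGeneralizedSolution m D) :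
    Ψ.IsTangentToImage D := by
  intro u
  obtain ⟨U, γ, hγ, x, hx, rfl⟩ := h.associated_integrable u
  have h1 := (h.comp_isIntegralSection U γ hγ).2 x hx
  rw [Function.comp_apply] at h1
  rw [← h1]
  rintro _ ⟨v, rfl⟩
  exact ⟨_, (DFunLike.congr_fun (Ψ.mfderiv_comp_section (hγ.1.mdifferentiableAt hx)) v).symm⟩

variable {Ψ}

theorem IsTangentToImage.tangentMap_dPt (hT : Ψ.IsTangentToImage D) {j : FirstJet π}
    (hj : Ψ.toFun j.pt = j) {w : JetModel B F} (hw : w ∈ D j) :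
    Ψ.tangentMap j.pt (j.dPt w) = w := by
  obtain ⟨u, rfl⟩ := Ψ.mem_range_iff.2 hj
  rw [Ψ.pt_toFun]
  exact Ψ.tangentMap_dPt (hT u hw)

/-- The expression, in the preferred chart of `J¹π` at `j₀`, of the retraction of `J¹π` onto the
image of a jet field. -/
def retraction (Ψ : JetField π) (j₀ : FirstJet π) (z : JetModel B F) : JetModel B F :=
  chartAt (JetModel B F) j₀ (Ψ.toFun ((chartAt (JetModel B F) j₀).symm z).pt)

theorem toFun_pt_mem_chartAt_source (Ψ : JetField π) {j₀ j : FirstJet π}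
    (hj : j ∈ (chartAt (JetModel B F) j₀).source) :
    Ψ.toFun j.pt ∈ (chartAt (JetModel B F) j₀).source := by
  rw [mem_chartAt_source] at hj ⊢
  rwa [Ψ.pt_toFun]

theorem contDiffAt_retraction (Ψ : JetField π) {j₀ : FirstJet π} {z : JetModel B F}
    (hz : z ∈ (chartAt (JetModel B F) j₀).target) : ContDiffAt ℝ ∞ (Ψ.retraction j₀) z := by
  have hj := (chartAt (JetModel B F) j₀).map_target hz
  have h1 : ContMDiffAt 𝓘(ℝ, JetModel B F) 𝓘(ℝ, JetModel B F) ∞ (chartAt (JetModel B F) j₀).symm z :=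
    contMDiffAt_symm_of_mem_maximalAtlas (IsManifold.chart_mem_maximalAtlas j₀) hz
  have h2 : ContMDiffAt 𝓘(ℝ, JetModel B F) 𝓘(ℝ, JetModel B F) ∞ (chartAt (JetModel B F) j₀)
      (Ψ.toFun ((chartAt (JetModel B F) j₀).symm z).pt) :=
    contMDiffAt_of_mem_maximalAtlas (IsManifold.chart_mem_maximalAtlas j₀)
      (Ψ.toFun_pt_mem_chartAt_source hj)
  have h3 : ContMDiffAt 𝓘(ℝ, JetModel B F) 𝓘(ℝ, JetModel B F) ∞
      (fun z => Ψ.toFun ((chartAt (JetModel B F) j₀).symm z).pt) z :=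
    ((Ψ.contMDiff.comp contMDiff_pt).contMDiffAt).comp z h1
  exact (ContMDiffAt.comp z h2 h3).contDiffAt

theorem retraction_retraction (Ψ : JetField π) {j₀ : FirstJet π} {z : JetModel B F}
    (hz : z ∈ (chartAt (JetModel B F) j₀).target) :
    Ψ.retraction j₀ (Ψ.retraction j₀ z) = Ψ.retraction j₀ z := by
  have hj := (chartAt (JetModel B F) j₀).map_target hz
  rw [retraction, retraction, (chartAt (JetModel B F) j₀).left_inv
    (Ψ.toFun_pt_mem_chartAt_source hj), Ψ.pt_toFun]

theorem retraction_chartAt (Ψ : JetField π) {j₀ j : FirstJet π}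
    (hj : j ∈ (chartAt (JetModel B F) j₀).source) :
    Ψ.retraction j₀ (chartAt (JetModel B F) j₀ j) =
      chartAt (JetModel B F) j₀ (Ψ.toFun j.pt) := by
  rw [retraction, (chartAt (JetModel B F) j₀).left_inv hj]

/-- In the chart, Im Ψ is the fixed-point set of the retraction. -/
theorem retraction_chartAt_eq_iff (Ψ : JetField π) {j₀ j : FirstJet π}
    (hj : j ∈ (chartAt (JetModel B F) j₀).source) :
    Ψ.retraction j₀ (chartAt (JetModel B F) j₀ j) = chartAt (JetModel B F) j₀ j ↔
      Ψ.toFun j.pt = j := by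
  rw [Ψ.retraction_chartAt hj]
  exact ⟨fun h => (pt_injOn_chart hj (Ψ.pt_toFun _).symm h.symm).symm, fun h => by rw [h]⟩

/-- The retraction has derivative TΨ ∘ Tπ¹, which is the identity on vectors tangent to Im Ψ, and
those include `D j`. -/
theorem IsTangentToImage.fderiv_retraction (hT : Ψ.IsTangentToImage D) {j₀ j : FirstJet π}
    (hj : j ∈ (chartAt (JetModel B F) j₀).source) (hΨj : Ψ.toFun j.pt = j) {w : JetModel B F}
    (hw : w ∈ D j) :
    fderiv ℝ (Ψ.retraction j₀) (chartAt (JetModel B F) j₀ j) (dChart j₀ j w) = dChart j₀ j w := by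
  set z := chartAt (JetModel B F) j₀ j
  have hz : z ∈ (chartAt (JetModel B F) j₀).target := (chartAt (JetModel B F) j₀).map_source hj
  have hjz : (chartAt (JetModel B F) j₀).symm z = j := (chartAt (JetModel B F) j₀).left_inv hj
  have h1 := (mdifferentiableAt_chartAt_symm hz).hasMFDerivAt
  have h2 : HasMFDerivAt 𝓘(ℝ, JetModel B F) 𝓘(ℝ, B × F) (FirstJet.pt (π := π))
      ((chartAt (JetModel B F) j₀).symm z) j.dPt := by
    rw [hjz]
    exact j.mdifferentiableAt_pt.hasMFDerivAt
  have h3 : HasMFDerivAt 𝓘(ℝ, B × F) 𝓘(ℝ, JetModel B F) Ψ.toFun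
      ((chartAt (JetModel B F) j₀).symm z).pt (Ψ.tangentMap j.pt) := by
    rw [hjz]
    exact (Ψ.mdifferentiableAt j.pt).hasMFDerivAt
  have h4 : HasMFDerivAt 𝓘(ℝ, JetModel B F) 𝓘(ℝ, JetModel B F) (chartAt (JetModel B F) j₀)
      (Ψ.toFun ((chartAt (JetModel B F) j₀).symm z).pt) (dChart j₀ j) := by
    rw [hjz, hΨj]
    exact (mdifferentiableAt_chartAt hj).hasMFDerivAt
  have h5 := (HasMFDerivAt.comp z h4 (HasMFDerivAt.comp z h3 (HasMFDerivAt.comp z h2 h1)))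
  have h6 : fderiv ℝ (Ψ.retraction j₀) z = dChart j₀ j ∘L Ψ.tangentMap j.pt ∘L j.dPt ∘L
      dChartSymm j₀ z := by
    rw [← mfderiv_eq_fderiv]
    exact h5.mfderiv
  rw [h6]
  change dChart j₀ j (Ψ.tangentMap j.pt (j.dPt (dChartSymm j₀ z (dChart j₀ j w)))) = _
  rw [dChartSymm_dChart hj, hT.tangentMap_dPt hΨj hw]

/-- The set of points sent into Im Ψ is open: `eventually_retraction_eq_of_tangent` is applied, in
charts at x₀ and ψ(x₀), to the retraction onto Im Ψ and a local frame of `D`. -/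
theorem IsTangentToImage.eventually_toFun_pt_eq (hT : Ψ.IsTangentToImage D)
    (hD : D.IsDistribution m) {U : Set M} {ψ : M → FirstJet π}
    (hψ : IsIntegralSection B FirstJet.projBase D U ψ) {x₀ : M} (hx₀ : x₀ ∈ U)
    (h₀ : Ψ.toFun (ψ x₀).pt = ψ x₀) : ∀ᶠ x in 𝓝 x₀, Ψ.toFun (ψ x).pt = ψ x := by
  set j₀ := ψ x₀ with hj₀
  set e := chartAt (JetModel B F) j₀
  set c := chartAt B x₀
  have hj₀s : j₀ ∈ e.source := mem_chart_source _ j₀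
  have hz₀ : e j₀ ∈ e.target := mem_chart_target _ j₀
  have hy₀ : c x₀ ∈ c.target := mem_chart_target _ x₀
  have hcx₀ : c.symm (c x₀) = x₀ := c.left_inv (mem_chart_source _ x₀)
  obtain ⟨W, hW, hjW, X, hX, hXD⟩ := hD j₀
  let Y : Fin m → FirstJet π → JetModel B F := fun i j => dChart j₀ j (X i j)
  have hYspan : ∀ j ∈ W, ∀ w ∈ D j, dChart j₀ j w ∈
      Submodule.span ℝ (Set.range fun i => Y i j) := by
    intro j hj w hw
    rw [← (hXD j hj).2] at hw
    exact (Submodule.map_span_range (dChart j₀ j : JetModel B F →ₗ[ℝ] JetModel B F)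
      fun i => X i j).le (Submodule.mem_map_of_mem hw)
  have hec : ContMDiffAt 𝓘(ℝ, JetModel B F) 𝓘(ℝ, JetModel B F) ∞ e (ψ (c.symm (c x₀))) := by
    rw [hcx₀]
    exact contMDiffAt_of_mem_maximalAtlas (IsManifold.chart_mem_maximalAtlas j₀) hj₀s
  have hcs : ContMDiffAt 𝓘(ℝ, B) 𝓘(ℝ, B) ∞ c.symm (c x₀) :=
    contMDiffAt_symm_of_mem_maximalAtlas (IsManifold.chart_mem_maximalAtlas x₀) hy₀
  have hψc : ContMDiffAt 𝓘(ℝ, B) 𝓘(ℝ, JetModel B F) ∞ ψ (c.symm (c x₀)) := by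
    rw [hcx₀]
    exact hψ.1.contMDiffOn.contMDiffAt (hψ.1.isOpen.mem_nhds hx₀)
  have hψcs : ContMDiffAt 𝓘(ℝ, B) 𝓘(ℝ, JetModel B F) ∞ (fun y => ψ (c.symm y)) (c x₀) :=
    hψc.comp _ hcs
  have key := eventually_retraction_eq_of_tangent (P := Ψ.retraction j₀)
    (X := fun i z => Y i (e.symm z)) (z₀ := e j₀) (f := fun y => e (ψ (c.symm y))) (x₀ := c x₀)
    (Ψ.contDiffAt_retraction hz₀)
    ((Ψ.retraction_chartAt_eq_iff hj₀s).2 h₀)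
    (by filter_upwards [e.open_target.mem_nhds hz₀] with z hz using Ψ.retraction_retraction hz)
    (fun i => (hX i).contDiffAt_chart hW hjW)
    (by
      rw [e.left_inv hj₀s]
      exact (hXD j₀ hjW).1.map' (dChart j₀ j₀ : JetModel B F →ₗ[ℝ] JetModel B F)
        (LinearMap.ker_eq_bot.2 (Function.LeftInverse.injective (g := dChartSymm j₀ (e j₀))
          fun v => dChartSymm_dChart hj₀s v)))
    (by
      have hcont : ContinuousAt e.symm (e j₀) := e.continuousAt_symm hz₀
      filter_upwards [e.open_target.mem_nhds hz₀,
        hcont (hW.mem_nhds (by rw [e.left_inv hj₀s]; exact hjW))] with z hz hzW hPz i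
      have hs := e.map_target hz
      have hez : e (e.symm z) = z := e.right_inv hz
      have h1 := Ψ.retraction_chartAt_eq_iff hs
      rw [hez] at h1
      have h2 := hT.fderiv_retraction hs (h1.1 hPz) (w := X i (e.symm z)) (by
        rw [← (hXD _ hzW).2]
        exact Submodule.subset_span ⟨i, rfl⟩)
      rwa [hez] at h2)
    (ContMDiffAt.comp (c x₀) hec hψcs).contDiffAt
    (by rw [hcx₀])
    (by
      have hcc : ContinuousAt c.symm (c x₀) := c.continuousAt_symm hy₀
      have h1 : ∀ᶠ y in 𝓝 (c x₀), c.symm y ∈ U :=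
        hcc (hψ.1.isOpen.mem_nhds (by rw [hcx₀]; exact hx₀))
      have h2 : ∀ᶠ y in 𝓝 (c x₀), ψ (c.symm y) ∈ W ∩ e.source :=
        hψcs.continuousAt ((hW.inter e.open_source).mem_nhds (by rw [hcx₀]; exact ⟨hjW, hj₀s⟩))
      filter_upwards [h1, h2, c.open_target.mem_nhds hy₀] with y hyU hyW hyc v
      have hd1 : MDifferentiableAt 𝓘(ℝ, B) 𝓘(ℝ, B) c.symm y :=
        (contMDiffAt_symm_of_mem_maximalAtlas (n := ∞) (IsManifold.chart_mem_maximalAtlas x₀)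
          hyc).mdifferentiableAt (by simp)
      have hd2 := hψ.1.mdifferentiableAt hyU
      have hd3 := mdifferentiableAt_chartAt hyW.2
      have h3 := HasMFDerivAt.comp y hd3.hasMFDerivAt
        (HasMFDerivAt.comp y hd2.hasMFDerivAt hd1.hasMFDerivAt)
      have h4 : fderiv ℝ (fun y => e (ψ (c.symm y))) y v = dChart j₀ (ψ (c.symm y))
          (mfderiv 𝓘(ℝ, B) 𝓘(ℝ, JetModel B F) ψ (c.symm y)
            (mfderiv 𝓘(ℝ, B) 𝓘(ℝ, B) c.symm y v)) := by
        rw [← mfderiv_eq_fderiv]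
        exact DFunLike.congr_fun h3.mfderiv v
      rw [h4, e.left_inv hyW.2]
      refine hYspan _ hyW.1 _ ?_
      rw [← hψ.2 _ hyU]
      exact ⟨_, rfl⟩)
  have hcx : ContinuousAt c x₀ := c.continuousAt (mem_chart_source _ x₀)
  have hψx : ∀ᶠ x in 𝓝 x₀, ψ x ∈ e.source :=
    (hψ.1.mdifferentiableAt hx₀).continuousAt (e.open_source.mem_nhds hj₀s)
  filter_upwards [hcx.eventually key, hψx,
    c.open_source.mem_nhds (mem_chart_source _ x₀)] with x hx hxs hxc
  rw [c.left_inv hxc] at hx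
  exact (Ψ.retraction_chartAt_eq_iff hxs).1 hx

/-- The complementary set is open too: ψ(x) and Ψ(π¹ ψ(x)) lie over the same point, so near x₀ one
chart contains and separates them. -/
theorem eventually_toFun_pt_ne (Ψ : JetField π) {ψ : M → FirstJet π} {x₀ : M}
    (hψ : ContinuousAt ψ x₀) (h₀ : Ψ.toFun (ψ x₀).pt ≠ ψ x₀) :
    ∀ᶠ x in 𝓝 x₀, Ψ.toFun (ψ x).pt ≠ ψ x := by
  set e := chartAt (JetModel B F) (ψ x₀)
  have hs : ψ x₀ ∈ e.source := mem_chart_source _ _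
  have h1 : ContinuousAt (fun x => e (ψ x)) x₀ := (e.continuousAt hs).comp hψ
  have h2 : ContinuousAt (fun x => Ψ.toFun (ψ x).pt) x₀ :=
    (Ψ.contMDiff.continuous.comp contMDiff_pt.continuous).continuousAt.comp hψ
  have h3 : ContinuousAt (fun x => e (Ψ.toFun (ψ x).pt)) x₀ :=
    ContinuousAt.comp (f := fun x => Ψ.toFun (ψ x).pt)
      (e.continuousAt (Ψ.toFun_pt_mem_chartAt_source hs)) h2
  have h4 : e (Ψ.toFun (ψ x₀).pt) ≠ e (ψ x₀) := fun h =>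
    h₀ (pt_injOn_chart hs (Ψ.pt_toFun _).symm h.symm).symm
  filter_upwards [(h3.sub h1).eventually_ne (sub_ne_zero.2 h4)] with x hx h
  exact hx (sub_eq_zero.2 (congrArg e h))

/-- An integral section of `D`, on a connected domain, that meets the image of a jet field to which
`D` is tangent, stays in this image. -/
theorem IsTangentToImage.toFun_pt_eq (hT : Ψ.IsTangentToImage D)
    (hD : D.IsDistribution m) {U : Set M} {ψ : M → FirstJet π}
    (hψ : Ψ.IsIntegralSectionMeetingImage D U ψ) {x : M} (hx : x ∈ U) :
    Ψ.toFun (ψ x).pt = ψ x := by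
  obtain ⟨hU, hψ, x₀, hx₀, h₀⟩ := hψ
  have hopen : IsOpen {x | x ∈ U ∧ Ψ.toFun (ψ x).pt = ψ x} := by
    rw [isOpen_iff_mem_nhds]
    rintro y ⟨hy, hy'⟩
    filter_upwards [hψ.1.isOpen.mem_nhds hy, hT.eventually_toFun_pt_eq hD hψ hy hy'] with z h1 h2
      using ⟨h1, h2⟩
  have hopen' : IsOpen {x | x ∈ U ∧ Ψ.toFun (ψ x).pt ≠ ψ x} := by
    rw [isOpen_iff_mem_nhds]
    rintro y ⟨hy, hy'⟩
    filter_upwards [hψ.1.isOpen.mem_nhds hy,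
      Ψ.eventually_toFun_pt_ne (hψ.1.mdifferentiableAt hy).continuousAt hy'] with z h1 h2
      using ⟨h1, h2⟩
  have hsub := hU.isPreconnected.subset_left_of_subset_union hopen hopen'
    (Set.disjoint_left.2 fun y h h' => h'.2 h.2)
    (fun y hy => by
      by_cases h : Ψ.toFun (ψ y).pt = ψ y
      · exact Or.inl ⟨hy, h⟩
      · exact Or.inr ⟨hy, h⟩)
    ⟨x₀, hx₀, hx₀, Ψ.mem_range_iff.1 h₀⟩
  exact (hsub hx).2

/-- The image of T(Ψ ∘ γ) is TΨ(Tπ¹ D), and TΨ ∘ Tπ¹ fixes `D` by tangency. -/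
theorem IsTangentToImage.comp_isIntegralSection (hT : Ψ.IsTangentToImage D) {U : Set M}
    {γ : M → E} (hγ : IsIntegralSection B π.proj (Ψ.associated D) U γ) :
    IsIntegralSection B FirstJet.projBase D U (Ψ.toFun ∘ γ) := by
  refine ⟨Ψ.isLocalSection_comp hγ.1, fun x hx => ?_⟩
  have h1 : ∀ v : B, (mfderiv 𝓘(ℝ, B) 𝓘(ℝ, JetModel B F) (Ψ.toFun ∘ γ) x v : JetModel B F) =
      Ψ.tangentMap (γ x) (mfderiv 𝓘(ℝ, B) 𝓘(ℝ, B × F) γ x v) := fun v =>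
    DFunLike.congr_fun (Ψ.mfderiv_comp_section (hγ.1.mdifferentiableAt hx)) v
  have h2 : ∀ a : B × F, (∃ v : B, mfderiv 𝓘(ℝ, B) 𝓘(ℝ, B × F) γ x v = a) ↔
      ∃ w : JetModel B F, w ∈ D (Ψ.toFun (γ x)) ∧ (Ψ.toFun (γ x)).dPt w = a := fun a =>
    SetLike.ext_iff.1 (hγ.2 x hx) a
  ext (w : JetModel B F)
  constructor
  · rintro ⟨v, hv⟩
    obtain ⟨w', hw', he⟩ := (h2 _).1 ⟨v, rfl⟩
    have h3 : w = w' := (hv.symm.trans (h1 v)).trans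
      ((congrArg (Ψ.tangentMap (γ x)) he.symm).trans (Ψ.tangentMap_dPt (hT _ hw')))
    rw [h3]
    exact hw'
  · intro hw
    obtain ⟨v, hv⟩ := (h2 _).2 ⟨w, hw, rfl⟩
    exact ⟨v, (h1 v).trans ((congrArg (Ψ.tangentMap (γ x)) hv).trans
      (Ψ.tangentMap_dPt (hT _ hw)))⟩

theorem IsTangentToImage.isIntegralSection_pt (hT : Ψ.IsTangentToImage D)
    (hD : D.IsDistribution m) {U : Set M} {ψ : M → FirstJet π}
    (hψ : Ψ.IsIntegralSectionMeetingImage D U ψ) :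
    IsIntegralSection B π.proj (Ψ.associated D) U (fun x => (ψ x).pt) := by
  refine ⟨⟨hψ.2.1.1.isOpen, contMDiff_pt.comp_contMDiffOn hψ.2.1.1.contMDiffOn,
    hψ.2.1.1.proj_eq⟩, fun x hx => ?_⟩
  have h1 := mfderiv_comp x (ψ x).mdifferentiableAt_pt (hψ.2.1.1.mdifferentiableAt hx)
  -- The associated distribution at π¹ ψ(x) is computed at Ψ(π¹ ψ(x)); it is the projection of `D (ψ
  -- x)` only because ψ stays in Im Ψ.
  have h2 : Ψ.associated D (ψ x).pt =
      Submodule.map ((ψ x).dPt : JetModel B F →ₗ[ℝ] B × F) (D (ψ x)) := by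
    rw [JetField.associated, hT.toFun_pt_eq hD hψ hx]
    rfl
  rw [h2, ← hψ.2.1.2 x hx]
  refine Eq.trans ?_ (LinearMap.range_comp _ _)
  exact congrArg (fun f : B →L[ℝ] B × F => f.range) h1

theorem IsTangentToImage.projectsOntoIntegralSections (hT : Ψ.IsTangentToImage D)
    (hD : D.IsDistribution m) : Ψ.ProjectsOntoIntegralSections D := by
  refine ⟨fun U ψ hψ => hT.isIntegralSection_pt hD hψ, fun U γ hU hγ => ?_⟩
  obtain ⟨x, hx⟩ := hU.nonempty
  exact ⟨Ψ.toFun ∘ γ, ⟨hU, hT.comp_isIntegralSection hγ, x, hx, ⟨γ x, rfl⟩⟩,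
    fun y _ => Ψ.pt_toFun _⟩

/-- The section ψ lying over γ is not assumed to be Ψ ∘ γ. Both equal j¹γ: ψ as an integral section
of `D`, Ψ ∘ γ because γ is an integral section of D(Ψ). -/
theorem ProjectsOntoIntegralSections.comp_isIntegralSection
    (h : Ψ.ProjectsOntoIntegralSections D) (hD : IsLagrangianDistribution η L D) {U : Set M}
    {γ : M → E} (hγ : IsIntegralSection B π.proj (Ψ.associated D) U γ) :
    IsIntegralSection B FirstJet.projBase D U (Ψ.toFun ∘ γ) := by
  refine ⟨Ψ.isLocalSection_comp hγ.1, fun x hx => ?_⟩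
  -- The hypothesis covers connected domains only, whereas `U` is arbitrary; being an integral
  -- section can be checked near each point.
  obtain ⟨V, hVU, hV, hxV, hVc⟩ :=
    ChartedSpace.exists_isOpen_isConnected_subset (B := B) hγ.1.isOpen hx
  have hγV := hγ.mono hV hVU
  obtain ⟨ψ, hψ, hψγ⟩ := h.2 V γ hVc hγV
  obtain ⟨φ, hφ, hψφ⟩ := hD.isProlongation V ψ hψ.2.1
  have hφγ : ∀ y ∈ V, φ y = γ y := fun y hy => by
    rw [← hψγ y hy, hψφ y hy]
    rfl
  rw [Ψ.associated_eq_distribution hD] at hγV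
  have heq : ∀ y ∈ V, ψ y = (Ψ.toFun ∘ γ) y := fun y hy => by
    rw [Function.comp_apply, Ψ.toFun_eq_prolongation hγV hy, hψφ y hy]
    have h1 : φ =ᶠ[𝓝 y] γ := by
      filter_upwards [hV.mem_nhds hy] with z hz using hφγ z hz
    exact FirstJet.ext_of_eq (hφγ y hy) h1.mfderiv_eq
  have h2 : ψ =ᶠ[𝓝 x] Ψ.toFun ∘ γ := by
    filter_upwards [hV.mem_nhds hxV] with z hz using heq z hz
  have h3 := hψ.2.1.2 x hxV
  rw [h2.mfderiv_eq, heq x hxV] at h3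
  exact h3

theorem ProjectsOntoIntegralSections.isGeneralizedSolution
    (h : Ψ.ProjectsOntoIntegralSections D) (hD : IsLagrangianDistribution η L D)
    (hint : Ψ.IsIntegrable) : Ψ.IsGeneralizedSolution m D where
  integrable := hint
  associated_isDistribution := Ψ.associated_isDistribution hD
  associated_integrable := by
    rw [Ψ.associated_eq_distribution hD]
    exact hint
  comp_isIntegralSection _ _ hγ := h.comp_isIntegralSection hD hγ

end JetField

end HamiltonJacobi

end

theorem mainTheorem4 {B F M E : Type*}
    [NormedAddCommGroup B] [NormedSpace ℝ B] [FiniteDimensional ℝ B]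
    [NormedAddCommGroup F] [NormedSpace ℝ F] [FiniteDimensional ℝ F]
    [TopologicalSpace M] [T2Space M] [SecondCountableTopology M]
    [ChartedSpace B M] [IsManifold 𝓘(ℝ, B) ∞ M]
    [TopologicalSpace E] [T2Space E] [SecondCountableTopology E]
    [ChartedSpace (B × F) E] [IsManifold 𝓘(ℝ, B × F) ∞ E]
    (π : SmoothBundle B F M E)
    (m : ℕ) (η : DiffForm B M m) (hη : η.IsVolumeForm)
    (L : FirstJet π → ℝ) (hL : ContMDiff 𝓘(ℝ, JetModel B F) 𝓘(ℝ, ℝ) ∞ L)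
    (hreg : IsRegularLagrangian L)
    (D : SubspaceField (JetModel B F) (FirstJet π)) (hD : IsLagrangianDistribution η L D)
    (Ψ : JetField π) (hint : Ψ.IsIntegrable)
    (hΨ : Ψ.pullback (multisymplecticCartanForm η L) = 0) :
    List.TFAE [
      Ψ.IsSolution η L D,
      Ψ.IsLagrangianImage (multisymplecticCartanForm η L) ∧ Ψ.IsTangentToImage D,
      Ψ.ProjectsOntoIntegralSections D] := by
  -- The Lagrangian half of statement 2 comes from Ψ^*Ω = 0 and regularity; only tangency uses the
  -- solution property.
  have h12 : Ψ.IsSolution η L D →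
      Ψ.IsLagrangianImage (multisymplecticCartanForm η L) ∧ Ψ.IsTangentToImage D := fun h =>
    ⟨Ψ.isLagrangianImage_multisymplecticCartanForm hη hL hreg hΨ,
      Ψ.isTangentToImage_of_isGeneralizedSolution h.1⟩
  have h23 : Ψ.IsLagrangianImage (multisymplecticCartanForm η L) ∧ Ψ.IsTangentToImage D →
      Ψ.ProjectsOntoIntegralSections D := fun h =>
    h.2.projectsOntoIntegralSections hD.isDistribution
  have h31 : Ψ.ProjectsOntoIntegralSections D → Ψ.IsSolution η L D := fun h =>
    ⟨h.isGeneralizedSolution hD hint, hΨ⟩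
  tfae_have 1 → 2 := h12
  tfae_have 2 → 3 := h23
  tfae_have 3 → 1 := h31
  tfae_finish
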